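/- Let $A>0$, $\alpha>0$, let $L\subset\mathbb R^2$ be a straight line through the origin, and put $f(x)=(1+A\,d_2(x,L))^\alpha$, where $d_2(x,L)$ is the Euclidean distance from $x$ to $L$. For an integer $N\ge 1$ let $\mathcal B_N=\{-N+1,\dots,N\}^2$, $F_N(k)=f\big(\tfrac{k_1-1/2}{N},\tfrac{k_2-1/2}{N}\big)$ for $k=(k_1,k_2)\in\mathcal B_N$, and let $\pi=F_N/\sum_{\mathcal B_N}F_N$. The Metropolis chain for $\pi$ is the Markov chain on $\mathcal B_N$ with kernel $M(k,l)=\frac14\min\{1,F_N(l)/F_N(k)\}$ if $|k_1-l_1|+|k_2-l_2|=1$, $M(k,l)=0$ for all other $l\ne k$, and $M(k,k)=1-\sum_{l\neq k}M(k,l)$. It is reversible with respect to $\pi$, with largest eigenvalue $1$. Let $\lambda=1-\beta_1$ be its spectral gap, where $\beta_1$ is the second largest eigenvalue of $M$. Fix $\epsilon\in(0,1)$ and $\alpha>0$. There are constants $0<c\le C<\infty$, depending only on $\epsilon$ and $\alpha$, such that for every line $L$ through the origin, every $A>0$ and every integer $N\ge1$ (with $N\ge 2$ if $\alpha=1$)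 such that $\epsilon A\le N\le A/\epsilon$, $$c\,r_\alpha(N)\le\lambda\le C\,r_\alpha(N),\qquad r_\alpha(N)=\begin{cases}\dfrac1{N^2}&\text{if }\alpha<1,\\[2mm]\dfrac1{N^2\log N}&\text{if }\alpha=1,\\[2mm]\dfrac1{N^{\alpha+1}}&\text{if }\alpha>1.\end{cases}$$ -/

import Mathlib

noncomputable section

namespace Valley

/-- The discrete box `{-N+1, …, N}²`. -/
abbrev Box (N : ℕ) : Type :=
  ↥(Finset.Icc (-(N : ℤ) + 1) (N : ℤ)) × ↥(Finset.Icc (-(N : ℤ) + 1) (N : ℤ))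

/-- The `ℓ¹` distance `|k₁ - l₁| + |k₂ - l₂|` on the box. -/
def gridDist {N : ℕ} (k l : Box N) : ℤ :=
  |(k.1 : ℤ) - (l.1 : ℤ)| + |(k.2 : ℤ) - (l.2 : ℤ)|

/-- A coordinate is extreme if it is one of the two end values `-N+1` and `N`. -/
def IsExtreme (N : ℕ) (a : ℤ) : Prop := a = -(N : ℤ) + 1 ∨ a = (N : ℤ)

open Classical in
/-- The proposal kernel: nearest-neighbour simple random walk on the box. It moves to each neighbour
with probability `1/4`, and holds with probability `1/4` if exactly one coordinate is extreme, and
`1/2` if both coordinates are extreme. -/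
def proposal (N : ℕ) (k l : Box N) : ℝ :=
  if gridDist k l = 1 then 1 / 4
  else if k = l then
    (if IsExtreme N k.1 then 1 / 4 else 0) + (if IsExtreme N k.2 then 1 / 4 else 0)
  else 0

open Classical in
/-- The Metropolis kernel with positive target weight `F`, based on the proposal kernel:
a proposed move from `k` to `l` is accepted with probability `min 1 (F l / F k)`,
and otherwise the chain stays at `k`. -/
def metropolis {N : ℕ} (F : Box N → ℝ) : Matrix (Box N) (Box N) ℝ := fun k l =>
  if k = l then
    proposal N k k +
      ∑ m : Box N, if gridDist k m = 1 ∧ F m < F k then (1 / 4) * (1 - F m / F k) else 0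
  else proposal N k l * min 1 (F l / F k)

/-- The probability measure `π` proportional to `F`. -/
def target {N : ℕ} (F : Box N → ℝ) (k : Box N) : ℝ := F k / ∑ m : Box N, F m

/-- The second largest eigenvalue (counted with multiplicity) of a kernel `M` that is reversible with
respect to `π`. The constants are eigenfunctions for the largest eigenvalue `1`, and `M` is
self-adjoint on `L²(π)`, so this is the largest eigenvalue of `M` having an eigenfunction that is
orthogonal to the constants in `L²(π)`. -/
def secondEigenvalue {B : Type*} [Fintype B] (M : Matrix B B ℝ) (π : B → ℝ) : ℝ :=
  sSup {β : ℝ | ∃ u : B → ℝ, u ≠ 0 ∧ ∑ x, u x * π x = 0 ∧ M.mulVec u = β • u}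

/-- The spectral gap `1 - β₁`, where `β₁` is the second largest eigenvalue. -/
def spectralGap {B : Type*} [Fintype B] (M : Matrix B B ℝ) (π : B → ℝ) : ℝ :=
  1 - secondEigenvalue M π

/-- The density `f(x) = (1 + A d₂(x, L)) ^ α` on the plane, `d₂` being Euclidean distance. -/
def density (A α : ℝ) (L : Submodule ℝ (EuclideanSpace ℝ (Fin 2)))
    (x : EuclideanSpace ℝ (Fin 2)) : ℝ :=
  (1 + A * Metric.infDist x (L : Set (EuclideanSpace ℝ (Fin 2)))) ^ α

/-- The discretized density `F_N(k) = f((k₁ - 1/2)/N, (k₂ - 1/2)/N)` on the box. -/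
def discreteDensity (N : ℕ) (A α : ℝ) (L : Submodule ℝ (EuclideanSpace ℝ (Fin 2)))
    (k : Box N) : ℝ :=
  density A α L !₂[(((k.1 : ℤ) : ℝ) - 1 / 2) / (N : ℝ), (((k.2 : ℤ) : ℝ) - 1 / 2) / (N : ℝ)]

/-- The spectral gap of the Metropolis chain on the box for the discretized density. -/
def valleyGap (N : ℕ) (A α : ℝ) (L : Submodule ℝ (EuclideanSpace ℝ (Fin 2))) : ℝ :=
  spectralGap (metropolis (discreteDensity N A α L)) (target (discreteDensity N A α L))

/-- The order of magnitude: `1/N²` if `α < 1`, `1/(N² log N)` if `α = 1`, and `1/N^(α+1)`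
if `α > 1`. -/
def rate (α : ℝ) (N : ℕ) : ℝ :=
  if α < 1 then 1 / (N : ℝ) ^ 2
  else if α = 1 then 1 / ((N : ℝ) ^ 2 * Real.log N)
  else 1 / (N : ℝ) ^ (α + 1)

end Valley

end

noncomputable section

namespace Valley

/-! ### Variational bounds for the spectral gap of a reversible kernel -/

section Spectral

variable {B : Type*} [Fintype B]

/-! The chain is slow because it has to cross the valley along `L`, so the gap has the order of
(conductance across the valley) / (mass of one side). In grid units the weight is `(1 + κ|h|)^α`,
where `h` is the signed distance to the line (`height`) and `κ = A / N` lies in `[ε, 1/ε]`; up to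
constants it is `(1 + |h|)^α`. One lattice path across the valley has resistance of order `P =
potential α N`, the integral of `(1 + t)^(-α)` over `[0, N]`. About `N` such paths run in parallel,
so the conductance is of order `N / P`, while the mass of each side is of order `N^(2 + α)`. Hence
the gap has order `1 / (N^(1 + α) P)`, and evaluating `P` gives the three regimes
(`rate_comparison`).

Both bounds come from the variational principle (`spectralGap_bounds`, `metropolis_gap_bounds`).
Symmetries of the square reduce them to a unit normal `(p, q)` with `0 ≤ p ≤ q`, so that every
column is transverse to the line.

Upper bound: the test function `potential α h` is odd, hence of mean zero. Its energy is at most of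
order `N P` (`energy_potential_le`), and its squared norm is at least of order `N^(2 + α) P²`
(`le_sum_weight_mul_potential_sq`).

Lower bound: a Poincaré inequality (`exists_poincare`). Every point is joined to a fixed one along
its own column, then along a row staying far from the line, then along a fixed column. The columns
cost `N^(1 + α) P`, the rows `N²`, and the latter is dominated by the former
(`sq_le_mul_potential`). -/

theorem symm_maximal_eigenvalue {E : Type*} [NormedAddCommGroup E] [InnerProductSpace ℝ E]
    [FiniteDimensional ℝ E] (T : E →ₗ[ℝ] E) (hT : T.IsSymmetric) (x : E) (hx : x ≠ 0) :
    ∃ (β : ℝ) (y : E), y ≠ 0 ∧ T y = β • y ∧ inner ℝ (T x) x ≤ β * ‖x‖ ^ 2 := by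
  have : Nontrivial E := ⟨x, 0, hx⟩
  obtain ⟨y, hy⟩ := (hT.hasEigenvalue_iSup_of_finiteDimensional).exists_hasEigenvector
  refine ⟨_, y, hy.2, hy.apply_eq_smul, ?_⟩
  have hpos : 0 < ‖x‖ ^ 2 := by positivity
  rw [← div_le_iff₀ hpos]
  -- The supremum of the Rayleigh quotient is an eigenvalue; using it as an upper bound requires
  -- boundedness, which the operator norm provides.
  refine le_ciSup (f := fun z : {z : E // z ≠ 0} => RCLike.re (inner ℝ (T z) (z : E)) / ‖(z : E)‖ ^ 2)
    ?_ ⟨x, hx⟩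
  refine ⟨‖LinearMap.toContinuousLinearMap T‖, ?_⟩
  rintro _ ⟨⟨z, hz⟩, rfl⟩
  have hz' : 0 < ‖z‖ ^ 2 := by positivity
  simp only [RCLike.re_to_real]
  rw [div_le_iff₀ hz']
  calc inner ℝ (T z) z ≤ ‖T z‖ * ‖z‖ := real_inner_le_norm _ _
    _ ≤ (‖LinearMap.toContinuousLinearMap T‖ * ‖z‖) * ‖z‖ := by
        gcongr
        exact (LinearMap.toContinuousLinearMap T).le_opNorm z
    _ = _ := by ring

/-- Conjugating `M` by the diagonal matrix `√F` makes it symmetric. It then fixes the vector `√F`,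
hence preserves the orthogonal complement, where the Rayleigh quotient is maximized by an
eigenvector. -/
theorem exists_eigenvector_ge_rayleigh (M : Matrix B B ℝ) (F : B → ℝ) (hF : ∀ k, 0 < F k)
    (hsymm : ∀ k l, F k * M k l = F l * M l k) (hrow : ∀ k, ∑ l, M k l = 1)
    (u : B → ℝ) (hu : u ≠ 0) (hu0 : ∑ k, u k * F k = 0) :
    ∃ (β : ℝ) (w : B → ℝ), w ≠ 0 ∧ ∑ k, w k * F k = 0 ∧ M.mulVec w = β • w ∧
      ∑ k, F k * u k * M.mulVec u k ≤ β * ∑ k, F k * u k ^ 2 := by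
  classical
  have hs : ∀ k, 0 < √(F k) := fun k => Real.sqrt_pos.2 (hF k)
  have hss : ∀ k, √(F k) * √(F k) = F k := fun k => Real.mul_self_sqrt (hF k).le
  let S : Matrix B B ℝ := Matrix.of fun k l => √(F k) * M k l / √(F l)
  let T := Matrix.toEuclideanLin S
  have hT : T.IsSymmetric := by
    apply Matrix.isSymmetric_toEuclideanLin_iff.2
    ext k l
    simp only [S, Matrix.conjTranspose_apply, Matrix.of_apply, star_trivial]
    rw [div_eq_div_iff (hs k).ne' (hs l).ne']
    have := hsymm k l
    rw [← hss k, ← hss l] at this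
    nlinarith
  have hTapp : ∀ (v : EuclideanSpace ℝ B) (k : B),
      T v k = √(F k) * M.mulVec (fun l => v l / √(F l)) k := by
    intro v k
    simp only [T, Matrix.ofLp_toLpLin, Matrix.toLin'_apply, Matrix.mulVec, dotProduct, S, Matrix.of_apply,
      Finset.mul_sum]
    refine Finset.sum_congr rfl fun l _ => by ring
  let g : EuclideanSpace ℝ B := WithLp.toLp 2 fun k => √(F k)
  have hg : T g = g := by
    ext k
    rw [hTapp]
    simp only [Matrix.mulVec, dotProduct, g, div_self (hs _).ne', mul_one, hrow]
  let V : Submodule ℝ (EuclideanSpace ℝ B) := (ℝ ∙ g)ᗮ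
  have hVmem : ∀ v, v ∈ V ↔ ∑ k, v k * √(F k) = 0 := by
    intro v
    simp only [V, Submodule.mem_orthogonal_singleton_iff_inner_right, PiLp.inner_apply, g,
      RCLike.inner_apply, conj_trivial]
  have hV : ∀ v ∈ V, T v ∈ V := by
    intro v hv
    rw [Submodule.mem_orthogonal_singleton_iff_inner_right] at hv ⊢
    rw [← hT, hg, hv]
  let x : EuclideanSpace ℝ B := WithLp.toLp 2 fun k => √(F k) * u k
  have hxV : x ∈ V := by
    rw [hVmem, ← hu0]
    refine Finset.sum_congr rfl fun k _ => ?_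
    simp only [x]
    linear_combination u k * hss k
  have hx0 : (⟨x, hxV⟩ : V) ≠ 0 := by
    intro h
    apply hu
    ext k
    have h1 : x = 0 := congrArg Subtype.val h
    have h2 : x k = 0 := by rw [h1]; rfl
    simpa [x, (hs k).ne'] using h2
  obtain ⟨β, ⟨y, hyV⟩, hy0, hy, hle⟩ :=
    symm_maximal_eigenvalue (T.restrict hV) (hT.restrict_invariant hV) ⟨x, hxV⟩ hx0
  have hTy : T y = β • y := congrArg Subtype.val hy
  refine ⟨β, fun k => y k / √(F k), ?_, ?_, ?_, ?_⟩
  · intro h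
    apply hy0
    ext k
    have := congrFun h k
    simpa [(hs k).ne'] using this
  · rw [← (hVmem y).1 hyV]
    refine Finset.sum_congr rfl fun k _ => ?_
    have := (hs k).ne'
    rw [div_mul_eq_mul_div, div_eq_iff this]
    linear_combination -y k * hss k
  · ext k
    have h1 := hTapp y k
    rw [hTy] at h1
    have := (hs k).ne'
    simp only [PiLp.smul_apply, smul_eq_mul, Pi.smul_apply] at h1 ⊢
    rw [← mul_div_assoc, h1]
    field_simp
  · have hxx : (fun l => x l / √(F l)) = u := by
      ext l
      have := (hs l).ne'
      simp only [x]; field_simp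
    have e1 : inner ℝ (T.restrict hV ⟨x, hxV⟩) (⟨x, hxV⟩ : V) =
        ∑ k, F k * u k * M.mulVec u k := by
      change inner ℝ (T x) x = _
      simp only [PiLp.inner_apply, RCLike.inner_apply, conj_trivial, hTapp, hxx]
      refine Finset.sum_congr rfl fun k _ => ?_
      simp only [x]
      linear_combination u k * M.mulVec u k * hss k
    have e2 : ‖(⟨x, hxV⟩ : V)‖ ^ 2 = ∑ k, F k * u k ^ 2 := by
      change ‖x‖ ^ 2 = _
      rw [EuclideanSpace.real_norm_sq_eq]
      refine Finset.sum_congr rfl fun k _ => ?_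
      simp only [x]
      linear_combination u k ^ 2 * hss k
    rw [e1, e2] at hle
    exact hle

theorem dirichlet_identity (M : Matrix B B ℝ) (F : B → ℝ)
    (hsymm : ∀ k l, F k * M k l = F l * M l k) (hrow : ∀ k, ∑ l, M k l = 1) (u : B → ℝ) :
    ∑ k, F k * u k ^ 2 - ∑ k, F k * u k * M.mulVec u k =
      (1 / 2) * ∑ k, ∑ l, F k * M k l * (u k - u l) ^ 2 := by
  have e1 : ∑ k, ∑ l, F k * M k l * u k ^ 2 = ∑ k, F k * u k ^ 2 := by
    refine Finset.sum_congr rfl fun k _ => ?_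
    rw [← Finset.sum_mul, ← Finset.mul_sum, hrow]; ring
  have e2 : ∑ k, ∑ l, F k * M k l * u l ^ 2 = ∑ k, F k * u k ^ 2 := by
    rw [Finset.sum_comm, ← e1]
    refine Finset.sum_congr rfl fun k _ => Finset.sum_congr rfl fun l _ => ?_
    rw [hsymm]
  have e3 : ∑ k, ∑ l, F k * M k l * (u k * u l) = ∑ k, F k * u k * M.mulVec u k := by
    refine Finset.sum_congr rfl fun k _ => ?_
    simp only [Matrix.mulVec, dotProduct, Finset.mul_sum]
    refine Finset.sum_congr rfl fun l _ => by ring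
  have e4 : ∑ k, ∑ l, F k * M k l * (u k - u l) ^ 2 =
      ∑ k, ∑ l, F k * M k l * u k ^ 2 + ∑ k, ∑ l, F k * M k l * u l ^ 2
        - 2 * ∑ k, ∑ l, F k * M k l * (u k * u l) := by
    simp only [Finset.mul_sum, ← Finset.sum_add_distrib, ← Finset.sum_sub_distrib]
    refine Finset.sum_congr rfl fun k _ => Finset.sum_congr rfl fun l _ => by ring
  rw [e4, e1, e2, e3]; ring

theorem sum_mul_target_eq_zero_iff {N : ℕ} (F : Box N → ℝ) (hF : ∀ k, 0 < F k) (u : Box N → ℝ) :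
    ∑ k, u k * target F k = 0 ↔ ∑ k, u k * F k = 0 := by
  simp only [target, ← mul_div_assoc, ← Finset.sum_div]
  rw [div_eq_zero_iff, or_iff_left_iff_imp]
  intro h
  rw [Finset.sum_eq_zero_iff_of_nonneg fun k _ => (hF k).le] at h
  exact Finset.sum_eq_zero fun k hk => absurd (h k hk) (hF k).ne'

/-- Upper and lower bounds for the spectral gap from a test function and a Poincaré inequality. -/
theorem spectralGap_bounds {N : ℕ} (M : Matrix (Box N) (Box N) ℝ) (F : Box N → ℝ)
    (hF : ∀ k, 0 < F k)
    (hsymm : ∀ k l, F k * M k l = F l * M l k) (hrow : ∀ k, ∑ l, M k l = 1)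
    {c : ℝ}
    (hc : ∀ w : Box N → ℝ, ∑ k, w k * F k = 0 →
      c * ∑ k, F k * w k ^ 2 ≤ (1 / 2) * ∑ k, ∑ l, F k * M k l * (w k - w l) ^ 2)
    (u : Box N → ℝ) (hu : u ≠ 0) (hu0 : ∑ k, u k * F k = 0) :
    c ≤ spectralGap M (target F) ∧
      spectralGap M (target F) * ∑ k, F k * u k ^ 2 ≤
        (1 / 2) * ∑ k, ∑ l, F k * M k l * (u k - u l) ^ 2 := by
  have hpos : ∀ w : Box N → ℝ, w ≠ 0 → 0 < ∑ k, F k * w k ^ 2 := by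
    intro w hw
    obtain ⟨k, hk⟩ := Function.ne_iff.1 hw
    refine Finset.sum_pos' (fun k _ => mul_nonneg (hF k).le (sq_nonneg _))
      ⟨k, Finset.mem_univ _, ?_⟩
    have : 0 < w k ^ 2 := by
      have : w k ≠ 0 := hk
      positivity
    exact mul_pos (hF k) this
  have hub : ∀ β ∈ {β : ℝ | ∃ u : Box N → ℝ, u ≠ 0 ∧ ∑ x, u x * target F x = 0 ∧
      M.mulVec u = β • u}, β ≤ 1 - c := by
    rintro β ⟨w, hw, hw0, hMw⟩
    rw [sum_mul_target_eq_zero_iff F hF] at hw0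
    have h1 := hc w hw0
    rw [← dirichlet_identity M F hsymm hrow, hMw] at h1
    have h2 : ∑ k, F k * w k * (β • w) k = β * ∑ k, F k * w k ^ 2 := by
      rw [Finset.mul_sum]
      refine Finset.sum_congr rfl fun k _ => ?_
      simp only [Pi.smul_apply, smul_eq_mul]; ring
    rw [h2] at h1
    have := hpos w hw
    have h3 : (c - (1 - β)) * ∑ k, F k * w k ^ 2 ≤ 0 := by linarith
    by_contra h
    have : 0 < (c - (1 - β)) * ∑ k, F k * w k ^ 2 := mul_pos (by linarith) this
    linarith
  obtain ⟨β, w, hw, hw0, hMw, hle⟩ := exists_eigenvector_ge_rayleigh M F hF hsymm hrow u hu hu0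
  have hmem : β ∈ {β : ℝ | ∃ u : Box N → ℝ, u ≠ 0 ∧ ∑ x, u x * target F x = 0 ∧
      M.mulVec u = β • u} := ⟨w, hw, (sum_mul_target_eq_zero_iff F hF w).2 hw0, hMw⟩
  -- The eigenvector obtained from `u` also shows that the set under the supremum is nonempty,
  -- without which the bound would say nothing.
  have h1 : secondEigenvalue M (target F) ≤ 1 - c := csSup_le ⟨β, hmem⟩ hub
  have h2 : β ≤ secondEigenvalue M (target F) := le_csSup ⟨_, hub⟩ hmem
  refine ⟨by unfold spectralGap; linarith, ?_⟩
  rw [← dirichlet_identity M F hsymm hrow]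
  have := hpos u hu
  have h3 := mul_le_mul_of_nonneg_right h2 this.le
  unfold spectralGap
  linarith

end Spectral

/-! ### The Metropolis kernel and its Dirichlet form -/

section Kernel

/-- The range `{-N+1, …, N}` of one coordinate. -/
abbrev side (N : ℕ) : Finset ℤ := Finset.Icc (-(N : ℤ) + 1) (N : ℤ)

theorem sum_box {N : ℕ} (g : ℤ → ℤ → ℝ) :
    ∑ k : Box N, g k.1 k.2 = ∑ a ∈ side N, ∑ b ∈ side N, g a b := by
  rw [Fintype.sum_prod_type]
  rw [← Finset.sum_coe_sort (side N) fun a => ∑ b ∈ side N, g a b]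
  refine Finset.sum_congr rfl fun a _ => ?_
  rw [← Finset.sum_coe_sort (side N)]

/-- At `ℓ¹` distance 1 exactly one coordinate changes, and it changes by 1. -/
theorem sum_neighbors {N : ℕ} (k : Box N) (g : ℤ → ℤ → ℝ) :
    (∑ l : Box N, if gridDist k l = 1 then g l.1 l.2 else 0) =
      (∑ a ∈ side N, if |(k.1 : ℤ) - a| = 1 then g a k.2 else 0) +
        ∑ b ∈ side N, if |(k.2 : ℤ) - b| = 1 then g k.1 b else 0 := by
  have h1 : ∀ a b : ℤ, (if |(k.1 : ℤ) - a| + |(k.2 : ℤ) - b| = 1 then g a b else 0) =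
      (if (k.2 : ℤ) = b then (if |(k.1 : ℤ) - a| = 1 then g a b else 0) else 0) +
      (if (k.1 : ℤ) = a then (if |(k.2 : ℤ) - b| = 1 then g a b else 0) else 0) := by
    intro a b
    split_ifs <;> first | (simp; done) | (exfalso; grind)
  have h2 : (∑ l : Box N, if gridDist k l = 1 then g l.1 l.2 else 0) = _ :=
    sum_box (N := N) fun a b => if |(k.1 : ℤ) - a| + |(k.2 : ℤ) - b| = 1 then g a b else 0
  rw [h2]
  simp only [h1, Finset.sum_add_distrib]
  congr 1
  · refine Finset.sum_congr rfl fun a _ => ?_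
    rw [Finset.sum_ite_eq, if_pos k.2.2]
  · rw [Finset.sum_comm]
    refine Finset.sum_congr rfl fun a _ => ?_
    rw [Finset.sum_ite_eq, if_pos k.1.2]

open Classical in
-- An extreme coordinate lacks exactly one of its two neighbours. This also holds for `N = 1`, where
-- both coordinates `0` and `1` are extreme.
theorem sum_side_neighbors {N : ℕ} {a : ℤ} (ha : a ∈ side N) (c : ℝ) :
    (∑ a' ∈ side N, if |a - a'| = 1 then c else 0) = 2 * c - if IsExtreme N a then c else 0 := by
  have h1 : ∀ a' : ℤ, (if |a - a'| = 1 then c else 0) =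
      (if a + 1 = a' then c else 0) + (if a - 1 = a' then c else 0) := by
    intro a'
    split_ifs <;> first | (simp; done) | (exfalso; grind)
  simp only [h1, Finset.sum_add_distrib, Finset.sum_ite_eq]
  by_cases h : IsExtreme N a
  · rw [if_pos h]
    simp only [side, Finset.mem_Icc, IsExtreme] at *
    split_ifs <;> first | ring1 | (exfalso; omega)
  · rw [if_neg h]
    simp only [side, Finset.mem_Icc, IsExtreme] at *
    split_ifs <;> first | ring1 | (exfalso; omega)

theorem gridDist_comm {N : ℕ} (k l : Box N) : gridDist k l = gridDist l k := by
  simp only [gridDist, abs_sub_comm]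

theorem gridDist_self {N : ℕ} (k : Box N) : gridDist k k = 0 := by simp [gridDist]

theorem sum_proposal {N : ℕ} (k : Box N) :
    proposal N k k + ∑ l : Box N, (if gridDist k l = 1 then (1 / 4 : ℝ) else 0) = 1 := by
  rw [sum_neighbors k fun _ _ => 1 / 4, sum_side_neighbors k.1.2, sum_side_neighbors k.2.2]
  simp only [proposal, gridDist_self, zero_ne_one, if_false, if_true]
  ring

theorem mul_metropolis {N : ℕ} (F : Box N → ℝ) (hF : ∀ k, 0 < F k) {k l : Box N} (hkl : k ≠ l) :
    F k * metropolis F k l = if gridDist k l = 1 then 1 / 4 * min (F k) (F l) else 0 := by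
  simp only [metropolis, if_neg hkl, proposal]
  split_ifs with h
  · have h1 : F k * min 1 (F l / F k) = min (F k) (F l) := by
      rw [mul_min_of_nonneg _ _ (hF k).le, mul_one, mul_div_cancel₀ _ (hF k).ne']
    linear_combination 1 / 4 * h1
  · simp

theorem metropolis_reversible {N : ℕ} (F : Box N → ℝ) (hF : ∀ k, 0 < F k) (k l : Box N) :
    F k * metropolis F k l = F l * metropolis F l k := by
  rcases eq_or_ne k l with rfl | h
  · rfl
  · rw [mul_metropolis F hF h, mul_metropolis F hF h.symm, gridDist_comm, min_comm]

theorem metropolis_row_sum {N : ℕ} (F : Box N → ℝ) (hF : ∀ k, 0 < F k) (k : Box N) :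
    ∑ l, metropolis F k l = 1 := by
  classical
  have h1 : ∀ l, metropolis F k l = (if l = k then metropolis F k k else 0) +
      if gridDist k l = 1 then 1 / 4 * min 1 (F l / F k) else 0 := by
    intro l
    rcases eq_or_ne l k with rfl | h
    · simp [gridDist_self]
    · simp only [if_neg h, metropolis, if_neg h.symm, proposal]
      split_ifs <;> simp
  rw [Finset.sum_congr rfl fun l _ => h1 l, Finset.sum_add_distrib, Finset.sum_ite_eq',
    if_pos (Finset.mem_univ _)]
  refine Eq.trans ?_ (sum_proposal k)
  simp only [metropolis, if_true]
  rw [add_assoc, ← Finset.sum_add_distrib]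
  congr 1
  refine Finset.sum_congr rfl fun l _ => ?_
  by_cases hd : gridDist k l = 1
  · by_cases hlt : F l < F k
    · have : F l / F k ≤ 1 := (div_le_one (hF k)).2 hlt.le
      simp only [hd, hlt, and_self, if_true, min_eq_right this]; ring
    · have : 1 ≤ F l / F k := (one_le_div (hF k)).2 (not_lt.1 hlt)
      simp [hd, hlt, min_eq_left this]
  · simp [hd]

/-- Eight times the unnormalized Dirichlet form of the Metropolis chain, for functions on `ℤ²`. -/
def energy (N : ℕ) (F u : ℤ → ℤ → ℝ) : ℝ :=
  ∑ a ∈ side N, ∑ b ∈ side N,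
    ((∑ a' ∈ side N, if |a - a'| = 1 then min (F a b) (F a' b) * (u a b - u a' b) ^ 2 else 0) +
      ∑ b' ∈ side N, if |b - b'| = 1 then min (F a b) (F a b') * (u a b - u a b') ^ 2 else 0)

theorem metropolis_energy {N : ℕ} (F u : ℤ → ℤ → ℝ) (hF : ∀ a b, 0 < F a b) :
    (1 / 2) * ∑ k : Box N, ∑ l : Box N, F k.1 k.2 *
      metropolis (fun k : Box N => F k.1 k.2) k l * (u k.1 k.2 - u l.1 l.2) ^ 2 =
      (1 / 8) * energy N F u := by
  have h1 : ∀ k : Box N, (∑ l : Box N, F k.1 k.2 *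
      metropolis (fun k : Box N => F k.1 k.2) k l * (u k.1 k.2 - u l.1 l.2) ^ 2) =
      1 / 4 * ((∑ a' ∈ side N, if |(k.1 : ℤ) - a'| = 1 then
          min (F k.1 k.2) (F a' k.2) * (u k.1 k.2 - u a' k.2) ^ 2 else 0) +
        ∑ b' ∈ side N, if |(k.2 : ℤ) - b'| = 1 then
          min (F k.1 k.2) (F k.1 b') * (u k.1 k.2 - u k.1 b') ^ 2 else 0) := by
    intro k
    rw [← sum_neighbors k fun a' b' => min (F k.1 k.2) (F a' b') * (u k.1 k.2 - u a' b') ^ 2,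
      Finset.mul_sum]
    refine Finset.sum_congr rfl fun l _ => ?_
    rcases eq_or_ne k l with rfl | h
    · simp [gridDist_self]
    · rw [mul_metropolis (fun k : Box N => F k.1 k.2) (fun _ => hF _ _) h]
      split_ifs
      · ring
      · simp
  rw [Finset.sum_congr rfl fun k _ => h1 k, ← Finset.mul_sum, energy]
  rw [sum_box fun a b =>
    ((∑ a' ∈ side N, if |a - a'| = 1 then min (F a b) (F a' b) * (u a b - u a' b) ^ 2 else 0) +
      ∑ b' ∈ side N, if |b - b'| = 1 then min (F a b) (F a b') * (u a b - u a b') ^ 2 else 0)]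
  ring

/-- Allows all later estimates to be made for functions on `ℤ²`, free of subtypes. -/
theorem exists_extension {N : ℕ} (u : Box N → ℝ) :
    ∃ v : ℤ → ℤ → ℝ, u = fun k : Box N => v k.1 k.2 := by
  classical
  refine ⟨fun a b => if h : a ∈ side N ∧ b ∈ side N then u (⟨a, h.1⟩, ⟨b, h.2⟩) else 0, ?_⟩
  ext k
  have h : (k.1 : ℤ) ∈ side N ∧ (k.2 : ℤ) ∈ side N := ⟨k.1.2, k.2.2⟩
  simp only [dif_pos h]

/-- The mean minimizes the weighted square deviation, so a Poincaré inequality may be centred at any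
constant. -/
theorem sum_sq_le_of_mean_zero {N : ℕ} {F u : ℤ → ℤ → ℝ} (hF : ∀ a b, 0 < F a b)
    (hu : ∑ a ∈ side N, ∑ b ∈ side N, u a b * F a b = 0) (c : ℝ) :
    ∑ a ∈ side N, ∑ b ∈ side N, F a b * u a b ^ 2 ≤
      ∑ a ∈ side N, ∑ b ∈ side N, F a b * (u a b - c) ^ 2 := by
  have h : ∑ a ∈ side N, ∑ b ∈ side N, F a b * (u a b - c) ^ 2 =
      ∑ a ∈ side N, ∑ b ∈ side N, F a b * u a b ^ 2 -
        2 * c * ∑ a ∈ side N, ∑ b ∈ side N, u a b * F a b +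
        c ^ 2 * ∑ a ∈ side N, ∑ b ∈ side N, F a b := by
    simp only [Finset.mul_sum, ← Finset.sum_add_distrib, ← Finset.sum_sub_distrib]
    refine Finset.sum_congr rfl fun a _ => Finset.sum_congr rfl fun b _ => by ring
  rw [h, hu]
  have : 0 ≤ ∑ a ∈ side N, ∑ b ∈ side N, F a b :=
    Finset.sum_nonneg fun a _ => Finset.sum_nonneg fun b _ => (hF a b).le
  nlinarith [mul_nonneg (sq_nonneg c) this]

/-- The spectral gap is at least `1 / (8 K)` if a Poincaré inequality with constant `K` holds, and at
most `K' / 8` if a test function has Rayleigh quotient at most `K'`. -/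
theorem metropolis_gap_bounds {N : ℕ} {F : ℤ → ℤ → ℝ} (hF : ∀ a b, 0 < F a b) {K K' : ℝ}
    (hK : 0 < K)
    (hpoincare : ∀ w : ℤ → ℤ → ℝ, ∃ c : ℝ,
      ∑ a ∈ side N, ∑ b ∈ side N, F a b * (w a b - c) ^ 2 ≤ K * energy N F w)
    {u : ℤ → ℤ → ℝ} (hu0 : ∑ a ∈ side N, ∑ b ∈ side N, u a b * F a b = 0)
    (hu : 0 < ∑ a ∈ side N, ∑ b ∈ side N, F a b * u a b ^ 2)
    (htest : energy N F u ≤ K' * ∑ a ∈ side N, ∑ b ∈ side N, F a b * u a b ^ 2) :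
    1 / (8 * K) ≤ spectralGap (metropolis fun k : Box N => F k.1 k.2)
        (target fun k : Box N => F k.1 k.2) ∧
      spectralGap (metropolis fun k : Box N => F k.1 k.2)
        (target fun k : Box N => F k.1 k.2) ≤ K' / 8 := by
  have hF' : ∀ k : Box N, 0 < F k.1 k.2 := fun k => hF _ _
  have hsq := sum_box (N := N) fun a b => F a b * u a b ^ 2
  obtain ⟨h1, h2⟩ := spectralGap_bounds (c := 1 / (8 * K)) _ _ hF'
    (metropolis_reversible _ hF') (metropolis_row_sum _ hF') (by
      intro w hw
      obtain ⟨v, rfl⟩ := exists_extension w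
      rw [metropolis_energy F v hF, sum_box fun a b => F a b * v a b ^ 2]
      rw [sum_box fun a b => v a b * F a b] at hw
      obtain ⟨c, hc⟩ := hpoincare v
      have := (sum_sq_le_of_mean_zero hF hw c).trans hc
      rw [div_mul_eq_mul_div, div_le_iff₀ (by positivity)]
      linarith) (fun k : Box N => u k.1 k.2) (by
      intro h
      rw [← hsq] at hu
      refine hu.ne' (Finset.sum_eq_zero fun k _ => ?_)
      have : u k.1 k.2 = 0 := congrFun h k
      rw [this]; ring) (by rw [sum_box fun a b => u a b * F a b, hu0])
  refine ⟨h1, ?_⟩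
  rw [metropolis_energy F u hF, hsq] at h2
  refine le_of_mul_le_mul_right ?_ hu
  linarith

end Kernel

/-! ### The resistance integral across the valley and its growth -/

section Potential

/-- The odd primitive of `(1 + |t|) ^ (-α)`. -/
def potential (α s : ℝ) : ℝ := ∫ t in (0 : ℝ)..s, (1 + |t|) ^ (-α)

variable {α : ℝ}

theorem one_add_abs_pos (t : ℝ) : 0 < 1 + |t| := by positivity

theorem continuous_one_add_abs_rpow (α : ℝ) : Continuous fun t : ℝ => (1 + |t|) ^ (-α) :=
  Continuous.rpow_const (by fun_prop) fun t => Or.inl (one_add_abs_pos t).ne'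

theorem potential_sub (α s t : ℝ) :
    potential α t - potential α s = ∫ x in s..t, (1 + |x|) ^ (-α) :=
  intervalIntegral.integral_interval_sub_left
    ((continuous_one_add_abs_rpow α).intervalIntegrable _ _)
    ((continuous_one_add_abs_rpow α).intervalIntegrable _ _)

theorem potential_neg (α s : ℝ) : potential α (-s) = -potential α s := by
  have h := intervalIntegral.integral_comp_neg (a := 0) (b := s) fun t : ℝ => (1 + |t|) ^ (-α)
  simp only [abs_neg, neg_zero] at h
  rw [potential, potential, h, intervalIntegral.integral_symm]

theorem potential_mono (α : ℝ) : Monotone (potential α) := by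
  intro s t h
  rw [← sub_nonneg, potential_sub]
  exact intervalIntegral.integral_nonneg h fun x _ => by positivity

/-- A step of length at most 1 changes `1 + |s|` by a factor of at most 2. -/
theorem one_add_abs_rpow_neg_le (hα : 0 < α) {s t : ℝ} (h : |s - t| ≤ 1) :
    (1 + |t|) ^ (-α) ≤ 2 ^ α * (1 + |s|) ^ (-α) := by
  have h1 : (1 + |s|) / 2 ≤ 1 + |t| := by
    have := abs_sub_abs_le_abs_sub s t
    have := abs_nonneg t
    linarith
  calc (1 + |t|) ^ (-α) ≤ ((1 + |s|) / 2) ^ (-α) :=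
        Real.rpow_le_rpow_of_nonpos (by positivity) h1 (by linarith)
    _ = 2 ^ α * (1 + |s|) ^ (-α) := by
        rw [Real.div_rpow (by positivity) (by norm_num), Real.rpow_neg (by norm_num : (0:ℝ) ≤ 2)]
        field_simp

theorem abs_potential_sub_le (hα : 0 < α) {s t : ℝ} (h : |s - t| ≤ 1) :
    |potential α s - potential α t| ≤ 2 ^ α * (1 + |s|) ^ (-α) := by
  rw [abs_sub_comm, potential_sub]
  have h1 : ∀ x ∈ Set.uIoc s t, ‖(1 + |x|) ^ (-α)‖ ≤ 2 ^ α * (1 + |s|) ^ (-α) := by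
    intro x hx
    rw [Real.norm_of_nonneg (by positivity)]
    apply one_add_abs_rpow_neg_le hα
    rw [abs_le] at *
    rcases Set.mem_uIoc.1 hx with hx | hx <;> constructor <;> linarith [hx.1, hx.2]
  have h2 := intervalIntegral.norm_integral_le_of_norm_le_const h1
  rw [Real.norm_eq_abs] at h2
  refine h2.trans ?_
  rw [abs_sub_comm] at h
  exact mul_le_of_le_one_right (by positivity) h

theorem one_add_abs_rpow_neg_le_potential_sub (hα : 0 < α) (s : ℝ) :
    (1 + |s|) ^ (-α) ≤ 2 ^ α * (potential α (s + 1) - potential α s) := by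
  rw [potential_sub, ← intervalIntegral.integral_const_mul]
  have h1 : ∫ _ in s..s + 1, (1 + |s|) ^ (-α) = (1 + |s|) ^ (-α) := by simp
  calc (1 + |s|) ^ (-α) = ∫ _ in s..s + 1, (1 + |s|) ^ (-α) := h1.symm
    _ ≤ _ := by
      refine intervalIntegral.integral_mono_on (by linarith) (by simp)
        (((continuous_one_add_abs_rpow α).const_mul _).intervalIntegrable _ _) ?_
      intro x hx
      apply one_add_abs_rpow_neg_le hα
      rw [abs_le]; constructor <;> linarith [hx.1, hx.2]

/-- After rescaling the variable by `r`, the integrand only gets smaller because it decreases in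
`|t|`. This absorbs constant factors in the argument of `potential`. -/
theorem potential_mul_le (hα : 0 < α) {r s : ℝ} (hr : 1 ≤ r) (hs : 0 ≤ s) :
    potential α (r * s) ≤ r * potential α s := by
  have hr0 : 0 < r := by linarith
  have h := intervalIntegral.integral_comp_mul_left (a := 0) (b := s)
    (fun t : ℝ => (1 + |t|) ^ (-α)) hr0.ne'
  rw [mul_zero, smul_eq_mul] at h
  have h2 : potential α (r * s) = r * ∫ x in (0 : ℝ)..s, (1 + |r * x|) ^ (-α) := by
    rw [h, potential]; field_simp
  rw [h2]
  refine mul_le_mul_of_nonneg_left ?_ hr0.le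
  refine intervalIntegral.integral_mono_on hs
    (((continuous_one_add_abs_rpow α).comp (continuous_const_mul r)).intervalIntegrable _ _)
    ((continuous_one_add_abs_rpow α).intervalIntegrable _ _) fun x _ => ?_
  refine Real.rpow_le_rpow_of_nonpos (one_add_abs_pos x) ?_ (by linarith)
  rw [abs_mul, abs_of_pos hr0]
  nlinarith [abs_nonneg x]

theorem mul_rpow_neg_le_potential (hα : 0 < α) {s : ℝ} (hs : 0 ≤ s) :
    s * (1 + s) ^ (-α) ≤ potential α s := by
  have h1 : ∫ _ in (0 : ℝ)..s, (1 + s) ^ (-α) = s * (1 + s) ^ (-α) := by simp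
  rw [← h1]
  refine intervalIntegral.integral_mono_on hs (by simp)
    ((continuous_one_add_abs_rpow α).intervalIntegrable _ _) fun x hx => ?_
  refine Real.rpow_le_rpow_of_nonpos (one_add_abs_pos x) ?_ (by linarith)
  rw [abs_of_nonneg hx.1]
  linarith [hx.2]

theorem potential_pos (hα : 0 < α) {s : ℝ} (hs : 0 < s) : 0 < potential α s :=
  lt_of_lt_of_le (by positivity) (mul_rpow_neg_le_potential hα hs.le)

theorem potential_eq_integral {s : ℝ} (hs : 0 ≤ s) :
    potential α s = ∫ t in (1 : ℝ)..(1 + s), t ^ (-α) := by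
  have h := intervalIntegral.integral_comp_add_left (a := 0) (b := s) (fun t : ℝ => t ^ (-α)) 1
  rw [add_zero] at h
  rw [← h, potential]
  refine intervalIntegral.integral_congr fun x hx => ?_
  rw [Set.uIcc_of_le hs] at hx
  simp only [abs_of_nonneg hx.1]

theorem potential_of_ne_one (hα : α ≠ 1) {s : ℝ} (hs : 0 ≤ s) :
    potential α s = ((1 + s) ^ (1 - α) - 1) / (1 - α) := by
  rw [potential_eq_integral hs, integral_rpow, Real.one_rpow]
  · ring_nf
  · right
    refine ⟨fun h => hα (by linarith), ?_⟩
    rw [Set.uIcc_of_le (by linarith)]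
    intro h; linarith [h.1]

theorem potential_one {s : ℝ} (hs : 0 ≤ s) : potential 1 s = Real.log (1 + s) := by
  rw [potential_eq_integral hs]
  simp only [Real.rpow_neg_one]
  rw [integral_inv_of_pos one_pos (by linarith), div_one]

/-- The quantity `1 / (N ^ (1 + α) * potential α N)` has the order of magnitude of `rate α N`. -/
theorem rate_comparison (hα : 0 < α) :
    ∃ c C : ℝ, 0 < c ∧ 0 < C ∧ ∀ N : ℕ, 1 ≤ N → (α = 1 → 2 ≤ N) →
      c * rate α N ≤ 1 / ((N : ℝ) ^ (1 + α) * potential α N) ∧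
        1 / ((N : ℝ) ^ (1 + α) * potential α N) ≤ C * rate α N := by
  -- With the rate written as `1 / D`, it suffices to compare denominators; inverting exchanges the
  -- upper and lower constants.
  suffices h : ∃ m M : ℝ, 0 < m ∧ 0 < M ∧ ∀ N : ℕ, 1 ≤ N → (α = 1 → 2 ≤ N) →
      ∃ D : ℝ, 0 < D ∧ rate α N = 1 / D ∧ m * D ≤ (N : ℝ) ^ (1 + α) * potential α N ∧
        (N : ℝ) ^ (1 + α) * potential α N ≤ M * D by
    obtain ⟨m, M, hm, hM, h⟩ := h
    refine ⟨1 / M, 1 / m, by positivity, by positivity, fun N hN hN' => ?_⟩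
    obtain ⟨D, hD, hr, h1, h2⟩ := h N hN hN'
    have hN0 : (0 : ℝ) < N := by exact_mod_cast hN
    have hP := potential_pos hα hN0
    rw [hr, one_div_mul_one_div, one_div_mul_one_div]
    exact ⟨one_div_le_one_div_of_le (by positivity) h2,
      one_div_le_one_div_of_le (by positivity) h1⟩
  rcases lt_trichotomy α 1 with h | h | h
  · have h' : 0 < 1 - α := by linarith
    refine ⟨2 ^ (-α), 2 / (1 - α), by positivity, by positivity, fun N hN _ => ?_⟩
    have hN1 : (1 : ℝ) ≤ N := by exact_mod_cast hN
    have hN0 : (0 : ℝ) < N := by linarith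
    refine ⟨(N : ℝ) ^ 2, by positivity, by rw [rate, if_pos h], ?_, ?_⟩
    · calc (2 : ℝ) ^ (-α) * (N : ℝ) ^ 2 = (N : ℝ) ^ (1 + α) * (N * (2 * N) ^ (-α)) := by
            rw [Real.mul_rpow (by norm_num) hN0.le, Real.rpow_add hN0, Real.rpow_neg hN0.le,
              Real.rpow_one]
            have : (N : ℝ) ^ α ≠ 0 := by positivity
            field_simp
        _ ≤ (N : ℝ) ^ (1 + α) * (N * (1 + N) ^ (-α)) := by
            gcongr ?_ * (?_ * ?_)
            exact Real.rpow_le_rpow_of_nonpos (by positivity) (by linarith) (by linarith)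
        _ ≤ _ := by
            gcongr
            exact mul_rpow_neg_le_potential hα hN0.le
    · rw [potential_of_ne_one h.ne hN0.le]
      have h3 : (1 + (N : ℝ)) ^ (1 - α) ≤ 2 * (N : ℝ) ^ (1 - α) := by
        calc (1 + (N : ℝ)) ^ (1 - α) ≤ (2 * N) ^ (1 - α) := by
              gcongr; linarith
          _ = 2 ^ (1 - α) * (N : ℝ) ^ (1 - α) := Real.mul_rpow (by norm_num) hN0.le
          _ ≤ 2 ^ (1 : ℝ) * (N : ℝ) ^ (1 - α) := by
              gcongr
              · norm_num
              · linarith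
          _ = _ := by rw [Real.rpow_one]
      calc (N : ℝ) ^ (1 + α) * (((1 + (N : ℝ)) ^ (1 - α) - 1) / (1 - α))
          ≤ (N : ℝ) ^ (1 + α) * (2 * (N : ℝ) ^ (1 - α) / (1 - α)) := by
            gcongr; linarith
        _ = 2 / (1 - α) * ((N : ℝ) ^ (1 + α) * (N : ℝ) ^ (1 - α)) := by ring
        _ = _ := by
            rw [← Real.rpow_add hN0, ← Real.rpow_natCast]
            norm_num
  · subst h
    refine ⟨1, 2, by norm_num, by norm_num, fun N hN h2 => ?_⟩
    have hN2 : (2 : ℝ) ≤ N := by exact_mod_cast h2 rfl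
    have hN0 : (0 : ℝ) < N := by linarith
    have hlog : 0 < Real.log N := Real.log_pos (by linarith)
    refine ⟨(N : ℝ) ^ 2 * Real.log N, by positivity, by rw [rate, if_neg (lt_irrefl _), if_pos rfl],
      ?_, ?_⟩
    all_goals
      rw [potential_one hN0.le, show (1 : ℝ) + 1 = ((2 : ℕ) : ℝ) by norm_num, Real.rpow_natCast]
    · rw [one_mul]
      gcongr
      linarith
    -- This uses `1 + N ≤ N²`, which needs `N ≥ 2`.
    · have : Real.log (1 + N) ≤ 2 * Real.log N := by
        rw [show 2 * Real.log N = Real.log ((N : ℝ) ^ 2) by rw [Real.log_pow]; norm_num]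
        apply Real.log_le_log (by linarith)
        nlinarith
      calc (N : ℝ) ^ 2 * Real.log (1 + N) ≤ (N : ℝ) ^ 2 * (2 * Real.log N) := by gcongr
        _ = _ := by ring
  · have h' : 0 < α - 1 := by linarith
    refine ⟨2 ^ (-α), 1 / (α - 1), by positivity, by positivity, fun N hN _ => ?_⟩
    have hN1 : (1 : ℝ) ≤ N := by exact_mod_cast hN
    have hN0 : (0 : ℝ) < N := by linarith
    refine ⟨(N : ℝ) ^ (α + 1), by positivity, by rw [rate, if_neg h.not_gt, if_neg h.ne'], ?_, ?_⟩
    -- For `α > 1` the potential stays between its value at 1, which is at least `2^(-α)`, and its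
    -- limit `1 / (α - 1)`.
    · rw [mul_comm, add_comm 1 α]
      gcongr
      refine le_trans ?_ (potential_mono α hN1)
      have := mul_rpow_neg_le_potential hα (zero_le_one' ℝ)
      norm_num at this
      exact this
    · rw [mul_comm, add_comm 1 α]
      gcongr
      rw [potential_of_ne_one h.ne' hN0.le, ← neg_div_neg_eq, neg_sub, neg_sub]
      gcongr
      have : 0 < (1 + (N : ℝ)) ^ (1 - α) := by positivity
      linarith

end Potential

/-! ### A Poincaré inequality by paths along columns and rows -/

section Poincare

theorem sum_Ico_int_telescope (g : ℤ → ℝ) {i j : ℤ} (h : i ≤ j) :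
    ∑ k ∈ Finset.Ico i j, (g k - g (k + 1)) = g i - g j := by
  induction j, h using Int.leInduction with
  | base => simp
  | succ j h ih =>
    have : Finset.Ico i (j + 1) = insert j (Finset.Ico i j) := by
      ext k; simp only [Finset.mem_Ico, Finset.mem_insert]; omega
    rw [this, Finset.sum_insert (by simp), ih]
    ring

/-- The weighted Cauchy–Schwarz inequality along a path. -/
theorem sub_sq_le_path (g ω : ℤ → ℝ) {lo hi i j : ℤ} (hω : ∀ k ∈ Finset.Ico lo hi, 0 < ω k)
    (hi' : i ∈ Finset.Icc lo hi) (hj' : j ∈ Finset.Icc lo hi) :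
    (g i - g j) ^ 2 ≤ (∑ k ∈ Finset.Ico lo hi, 1 / ω k) *
      ∑ k ∈ Finset.Ico lo hi, ω k * (g k - g (k + 1)) ^ 2 := by
  wlog hij : i ≤ j generalizing i j
  · rw [← neg_sub, neg_sq]
    exact this hj' hi' (by omega)
  rw [Finset.mem_Icc] at hi' hj'
  have hsub : Finset.Ico i j ⊆ Finset.Ico lo hi := Finset.Ico_subset_Ico hi'.1 hj'.2
  rw [← sum_Ico_int_telescope g hij]
  have h1 : ∀ k ∈ Finset.Ico lo hi, 0 ≤ 1 / ω k := fun k hk => (one_div_pos.2 (hω k hk)).le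
  have h2 : ∀ k ∈ Finset.Ico lo hi, 0 ≤ ω k * (g k - g (k + 1)) ^ 2 := fun k hk =>
    mul_nonneg (hω k hk).le (sq_nonneg _)
  calc (∑ k ∈ Finset.Ico i j, (g k - g (k + 1))) ^ 2
      ≤ (∑ k ∈ Finset.Ico i j, 1 / ω k) * ∑ k ∈ Finset.Ico i j, ω k * (g k - g (k + 1)) ^ 2 := by
        refine Finset.sum_sq_le_sum_mul_sum_of_sq_le_mul _ (fun k hk => h1 k (hsub hk))
          (fun k hk => h2 k (hsub hk)) fun k hk => ?_
        have := (hω k (hsub hk)).ne'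
        exact le_of_eq (by field_simp)
    _ ≤ _ := by
        refine mul_le_mul (Finset.sum_le_sum_of_subset_of_nonneg hsub fun k hk _ => h1 k hk)
          (Finset.sum_le_sum_of_subset_of_nonneg hsub fun k hk _ => h2 k hk)
          (Finset.sum_nonneg fun k hk => h2 k (hsub hk)) (Finset.sum_nonneg h1)

/-- The minimum is at most the average. It selects a column or row whose energy is at most a
constant times `E / N`. -/
theorem exists_mul_le_of_sum_le {ι : Type*} {s : Finset ι} {f : ι → ℝ} {r E : ℝ} (hr : 0 < r)
    (hcard : r ≤ s.card) (hf : ∀ i ∈ s, 0 ≤ f i) (hsum : ∑ i ∈ s, f i ≤ E) :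
    ∃ i ∈ s, r * f i ≤ E := by
  have hs : s.Nonempty := by
    rw [← Finset.card_pos]
    exact_mod_cast hr.trans_le hcard
  obtain ⟨i, hi, hmin⟩ := s.exists_min_image f hs
  refine ⟨i, hi, le_trans ?_ hsum⟩
  calc r * f i ≤ s.card * f i := mul_le_mul_of_nonneg_right hcard (hf i hi)
    _ = s.card • f i := by rw [nsmul_eq_mul]
    _ ≤ _ := Finset.card_nsmul_le_sum _ _ _ hmin

/-- The vertical part of the energy in the column `a`. -/
def columnEnergy (N : ℕ) (F u : ℤ → ℤ → ℝ) (a : ℤ) : ℝ :=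
  ∑ b ∈ Finset.Ico (-(N : ℤ) + 1) N, min (F a b) (F a (b + 1)) * (u a b - u a (b + 1)) ^ 2

/-- The horizontal part of the energy in the row `b`. -/
def rowEnergy (N : ℕ) (F u : ℤ → ℤ → ℝ) (b : ℤ) : ℝ :=
  ∑ a ∈ Finset.Ico (-(N : ℤ) + 1) N, min (F a b) (F (a + 1) b) * (u a b - u (a + 1) b) ^ 2

variable {N : ℕ} {F u : ℤ → ℤ → ℝ}

theorem columnEnergy_nonneg (hF : ∀ a b, 0 < F a b) (a : ℤ) : 0 ≤ columnEnergy N F u a :=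
  Finset.sum_nonneg fun b _ => mul_nonneg (lt_min (hF a b) (hF a (b + 1))).le (sq_nonneg _)

theorem rowEnergy_nonneg (hF : ∀ a b, 0 < F a b) (b : ℤ) : 0 ≤ rowEnergy N F u b :=
  Finset.sum_nonneg fun a _ => mul_nonneg (lt_min (hF a b) (hF (a + 1) b)).le (sq_nonneg _)

theorem sum_Ico_succ_le_sum_neighbors (g : ℤ → ℤ → ℝ) (hg : ∀ a b, 0 ≤ g a b) :
    ∑ a ∈ Finset.Ico (-(N : ℤ) + 1) N, g a (a + 1) ≤
      ∑ a ∈ side N, ∑ a' ∈ side N, if |a - a'| = 1 then g a a' else 0 := by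
  have h0 : ∀ a a' : ℤ, 0 ≤ if |a - a'| = 1 then g a a' else 0 := by
    intro a a'; split_ifs
    · exact hg _ _
    · exact le_rfl
  calc ∑ a ∈ Finset.Ico (-(N : ℤ) + 1) N, g a (a + 1)
      ≤ ∑ a ∈ Finset.Ico (-(N : ℤ) + 1) N,
          ∑ a' ∈ side N, if |a - a'| = 1 then g a a' else 0 := by
        refine Finset.sum_le_sum fun a ha => ?_
        have hmem : a + 1 ∈ side N := by
          simp only [Finset.mem_Ico, side, Finset.mem_Icc] at *; omega
        refine le_trans ?_ (Finset.single_le_sum (fun a' _ => h0 a a') hmem)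
        simp
    _ ≤ _ := Finset.sum_le_sum_of_subset_of_nonneg
        (fun a ha => by simp only [Finset.mem_Ico, side, Finset.mem_Icc] at *; omega)
        fun a _ _ => Finset.sum_nonneg fun a' _ => h0 a a'

/-- The full energy counts every edge in both orientations, the column and row energies in one only.
-/
theorem sum_columnEnergy_add_sum_rowEnergy_le (hF : ∀ a b, 0 < F a b) :
    ∑ a ∈ side N, columnEnergy N F u a + ∑ b ∈ side N, rowEnergy N F u b ≤ energy N F u := by
  have hm : ∀ a b a' b' (x : ℝ), 0 ≤ min (F a b) (F a' b') * x ^ 2 := fun a b a' b' x =>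
    mul_nonneg (lt_min (hF a b) (hF a' b')).le (sq_nonneg _)
  have h : energy N F u =
      (∑ a ∈ side N, ∑ b ∈ side N, ∑ b' ∈ side N, if |b - b'| = 1 then
        min (F a b) (F a b') * (u a b - u a b') ^ 2 else 0) +
      ∑ b ∈ side N, ∑ a ∈ side N, ∑ a' ∈ side N, if |a - a'| = 1 then
        min (F a b) (F a' b) * (u a b - u a' b) ^ 2 else 0 := by
    simp only [energy, Finset.sum_add_distrib]
    rw [add_comm]
    congr 1
    rw [Finset.sum_comm]
  rw [h]
  refine add_le_add (Finset.sum_le_sum fun a _ => ?_) (Finset.sum_le_sum fun b _ => ?_)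
  · exact sum_Ico_succ_le_sum_neighbors
      (fun b b' => min (F a b) (F a b') * (u a b - u a b') ^ 2) fun b b' => hm _ _ _ _ _
  · exact sum_Ico_succ_le_sum_neighbors
      (fun a a' => min (F a b) (F a' b) * (u a b - u a' b) ^ 2) fun a a' => hm _ _ _ _ _

theorem sub_sq_le_columnEnergy (hF : ∀ a b, 0 < F a b) {a b b' : ℤ} (hb : b ∈ side N)
    (hb' : b' ∈ side N) {S : ℝ}
    (hS : ∑ b ∈ Finset.Ico (-(N : ℤ) + 1) N, 1 / min (F a b) (F a (b + 1)) ≤ S) :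
    (u a b - u a b') ^ 2 ≤ S * columnEnergy N F u a :=
  (sub_sq_le_path (u a) (fun b => min (F a b) (F a (b + 1)))
    (fun _ _ => lt_min (hF _ _) (hF _ _)) hb hb').trans
    (mul_le_mul_of_nonneg_right hS (columnEnergy_nonneg hF a))

theorem sub_sq_le_rowEnergy (hF : ∀ a b, 0 < F a b) {lo hi a a' b : ℤ} {m : ℝ} (hm : 0 < m)
    (hlo : -(N : ℤ) + 1 ≤ lo) (hhi : hi ≤ N)
    (ha : a ∈ Finset.Icc lo hi) (ha' : a' ∈ Finset.Icc lo hi)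
    (hFm : ∀ a ∈ Finset.Icc lo hi, m ≤ F a b) :
    (u a b - u a' b) ^ 2 ≤ 2 * N / m * rowEnergy N F u b := by
  have hsub : Finset.Ico lo hi ⊆ Finset.Ico (-(N : ℤ) + 1) N := Finset.Ico_subset_Ico hlo hhi
  have hpos : ∀ a, 0 < min (F a b) (F (a + 1) b) := fun a => lt_min (hF _ _) (hF _ _)
  refine (sub_sq_le_path (fun a => u a b) (fun a => min (F a b) (F (a + 1) b))
    (fun a _ => hpos a) ha ha').trans ?_
  refine mul_le_mul ?_ (Finset.sum_le_sum_of_subset_of_nonneg hsub fun k _ _ =>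
    mul_nonneg (hpos k).le (sq_nonneg _))
    (Finset.sum_nonneg fun k _ => mul_nonneg (hpos k).le (sq_nonneg _)) (by positivity)
  calc ∑ k ∈ Finset.Ico lo hi, 1 / min (F k b) (F (k + 1) b)
      ≤ ∑ k ∈ Finset.Ico lo hi, 1 / m := by
        refine Finset.sum_le_sum fun k hk => one_div_le_one_div_of_le hm (le_min ?_ ?_)
        · refine hFm k ?_
          simp only [Finset.mem_Icc, Finset.mem_Ico] at *; omega
        · refine hFm (k + 1) ?_
          simp only [Finset.mem_Icc, Finset.mem_Ico] at *; omega
    _ = ((hi - lo).toNat : ℝ) * (1 / m) := by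
        rw [Finset.sum_const, Int.card_Ico, nsmul_eq_mul]
    _ ≤ (2 * N : ℝ) * (1 / m) := by
        gcongr
        have : (hi - lo).toNat ≤ 2 * N := by omega
        exact_mod_cast this
    _ = _ := by ring

theorem card_side (N : ℕ) : (side N).card = 2 * N := by
  rw [side, Int.card_Icc]; omega

/-- A Poincaré inequality on the box. Each column is crossed with resistance at most `S`, and the
columns are joined along rows on which the weight is at least `m`: high rows to the right of the
central axis, and low rows to its left. -/
theorem exists_poincare (hN : 1 ≤ N) (hF : ∀ a b, 0 < F a b) {W S m : ℝ} (hm : 0 < m)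
    (hW : ∀ a ∈ side N, ∀ b ∈ side N, F a b ≤ W)
    (hS : ∀ a ∈ side N,
      ∑ b ∈ Finset.Ico (-(N : ℤ) + 1) N, 1 / min (F a b) (F a (b + 1)) ≤ S)
    (hhigh : ∀ a b : ℤ, 1 ≤ a → (N : ℤ) ≤ 2 * b → m ≤ F a b)
    (hlow : ∀ a b : ℤ, 4 * a ≤ N + 4 → 2 * b ≤ 2 - (N : ℤ) → m ≤ F a b)
    (u : ℤ → ℤ → ℝ) :
    ∃ c : ℝ, ∑ a ∈ side N, ∑ b ∈ side N, F a b * (u a b - c) ^ 2 ≤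
      W * (54 * N * S + 48 * N ^ 2 / m) * energy N F u := by
  have hN0 : (0 : ℝ) < N := by exact_mod_cast hN
  have hsum := sum_columnEnergy_add_sum_rowEnergy_le (N := N) (u := u) hF
  have hcol0 : ∀ a, 0 ≤ columnEnergy N F u a := columnEnergy_nonneg hF
  have hrow0 : ∀ b, 0 ≤ rowEnergy N F u b := rowEnergy_nonneg hF
  have hsc0 : 0 ≤ ∑ a ∈ side N, columnEnergy N F u a := Finset.sum_nonneg fun a _ => hcol0 a
  have hsr0 : 0 ≤ ∑ b ∈ side N, rowEnergy N F u b := Finset.sum_nonneg fun b _ => hrow0 b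
  have hsc : ∑ a ∈ side N, columnEnergy N F u a ≤ energy N F u := by linarith
  have hsr : ∑ b ∈ side N, rowEnergy N F u b ≤ energy N F u := by linarith
  have hE0 : 0 ≤ energy N F u := by linarith
  have hpick : ∀ (s : Finset ℤ) (f : ℤ → ℝ) (r : ℝ), (∀ i, 0 ≤ f i) →
      ∑ i ∈ side N, f i ≤ energy N F u → 0 < r → s ⊆ side N → r ≤ s.card →
      ∃ i ∈ s, i ∈ side N ∧ r * f i ≤ energy N F u := by
    intro s f r hf hfE hr hs hcard
    obtain ⟨i, hi, h⟩ := exists_mul_le_of_sum_le hr hcard (fun i _ => hf i)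
      ((Finset.sum_le_sum_of_subset_of_nonneg hs fun i _ _ => hf i).trans hfE)
    exact ⟨i, hi, hs hi, h⟩
  -- The common column `z` lies in `[1, N/4 + 1]`: right of the axis, hence reachable along high
  -- rows, yet far enough left to be reachable along low rows.
  obtain ⟨z, hz, hzN, hzE⟩ := hpick (Finset.Icc 1 ((N / 4 : ℕ) + 1)) (columnEnergy N F u) (N / 4)
    hcol0 hsc (by positivity)
    (fun i hi => by simp only [side, Finset.mem_Icc] at *; omega) (by
      rw [Int.card_Icc]
      have : N ≤ 4 * ((((N / 4 : ℕ) : ℤ) + 1 + 1 - 1).toNat) := by omega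
      have : (N : ℝ) ≤ 4 * (((((N / 4 : ℕ) : ℤ) + 1 + 1 - 1).toNat : ℕ) : ℝ) := by
        exact_mod_cast this
      linarith)
  obtain ⟨h, hh, hhN, hhE⟩ := hpick (Finset.Icc (((N + 1) / 2 : ℕ) : ℤ) N) (rowEnergy N F u) (N / 2)
    hrow0 hsr (by positivity)
    (fun i hi => by simp only [side, Finset.mem_Icc] at *; omega) (by
      rw [Int.card_Icc]
      have : N ≤ 2 * (((N : ℤ) + 1 - (((N + 1) / 2 : ℕ) : ℤ)).toNat) := by omega
      have : (N : ℝ) ≤ 2 * ((((N : ℤ) + 1 - (((N + 1) / 2 : ℕ) : ℤ)).toNat : ℕ) : ℝ) := by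
        exact_mod_cast this
      linarith)
  obtain ⟨l, hl, hlN, hlE⟩ := hpick (Finset.Icc (-(N : ℤ) + 1) (1 - (((N + 1) / 2 : ℕ) : ℤ)))
    (rowEnergy N F u) (N / 2) hrow0 hsr (by positivity)
    (fun i hi => by simp only [side, Finset.mem_Icc] at *; omega) (by
      rw [Int.card_Icc]
      have : N ≤ 2 * ((1 - (((N + 1) / 2 : ℕ) : ℤ) + 1 - (-(N : ℤ) + 1)).toNat) := by omega
      have : (N : ℝ) ≤
          2 * (((1 - (((N + 1) / 2 : ℕ) : ℤ) + 1 - (-(N : ℤ) + 1)).toNat : ℕ) : ℝ) := by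
        exact_mod_cast this
      linarith)
  simp only [Finset.mem_Icc] at hz hh hl
  have hS0 : 0 ≤ S := le_trans (Finset.sum_nonneg fun b _ =>
    (one_div_pos.2 (lt_min (hF _ _) (hF _ _))).le) (hS z hzN)
  have hW0 : 0 ≤ W := (hF z z).le.trans (hW z hzN z hzN)
  -- Columns with `a ≥ 1` are joined to `z` along the high row `h`, the others along the low row
  -- `l`; in both cases the segment stays where the weight is at least `m`.
  have hconn : ∀ a ∈ side N, ∃ b ∈ side N,
      (u a b - u z b) ^ 2 ≤ 4 / m * energy N F u := by
    have hscale : ∀ b, (N : ℝ) / 2 * rowEnergy N F u b ≤ energy N F u →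
        2 * N / m * rowEnergy N F u b ≤ 4 / m * energy N F u := by
      intro b hb
      calc 2 * N / m * rowEnergy N F u b = 4 / m * (N / 2 * rowEnergy N F u b) := by ring
        _ ≤ _ := by gcongr
    intro a ha
    rcases le_or_gt 1 a with h1 | h1
    · refine ⟨h, hhN, le_trans ?_ (hscale h hhE)⟩
      refine sub_sq_le_rowEnergy (lo := 1) (hi := N) hF hm (by omega) le_rfl ?_ ?_ ?_
      · simp only [side, Finset.mem_Icc] at *; omega
      · simp only [side, Finset.mem_Icc] at *; omega
      · intro x hx
        rw [Finset.mem_Icc] at hx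
        exact hhigh x h hx.1 (by omega)
    · refine ⟨l, hlN, le_trans ?_ (hscale l hlE)⟩
      refine sub_sq_le_rowEnergy (lo := -(N : ℤ) + 1) (hi := z) hF hm le_rfl
        (by simp only [side, Finset.mem_Icc] at hzN; omega) ?_ ?_ ?_
      · simp only [side, Finset.mem_Icc] at *; omega
      · simp only [side, Finset.mem_Icc] at *; omega
      · intro x hx
        rw [Finset.mem_Icc] at hx
        exact hlow x l (by omega) (by omega)
  set E := energy N F u
  have hzE' : columnEnergy N F u z ≤ 4 / N * E := by
    rw [div_mul_eq_mul_div, le_div_iff₀ hN0]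
    linarith
  refine ⟨u z h, ?_⟩
  -- The path is `(a, b) → (a, r) → (z, r) → (z, h)`, with `r` one of `h`, `l`; the factor 3 comes
  -- from squaring a sum of three increments.
  have hpt : ∀ a ∈ side N, ∀ b ∈ side N, F a b * (u a b - u z h) ^ 2 ≤
      W * (3 * (S * columnEnergy N F u a + (4 / m * E + S * (4 / N * E)))) := by
    intro a ha b hb
    obtain ⟨r, hr, har⟩ := hconn a ha
    have h1 := sub_sq_le_columnEnergy (u := u) hF hb hr (hS a ha)
    have h2 := sub_sq_le_columnEnergy (u := u) hF hr hhN (hS z hzN)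
    have h3 : S * columnEnergy N F u z ≤ S * (4 / N * E) := by gcongr
    refine mul_le_mul (hW a ha b hb) ?_ (sq_nonneg _) hW0
    have h4 : (u a b - u z h) ^ 2 ≤
        3 * ((u a b - u a r) ^ 2 + (u a r - u z r) ^ 2 + (u z r - u z h) ^ 2) := by
      nlinarith [sq_nonneg ((u a b - u a r) - (u a r - u z r)),
        sq_nonneg ((u a b - u a r) - (u z r - u z h)),
        sq_nonneg ((u a r - u z r) - (u z r - u z h))]
    linarith
  calc ∑ a ∈ side N, ∑ b ∈ side N, F a b * (u a b - u z h) ^ 2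
      ≤ ∑ a ∈ side N, ∑ b ∈ side N,
          W * (3 * (S * columnEnergy N F u a + (4 / m * E + S * (4 / N * E)))) :=
        Finset.sum_le_sum fun a ha => Finset.sum_le_sum fun b hb => hpt a ha b hb
    _ = W * (3 * (2 * N * (S * (∑ a ∈ side N, columnEnergy N F u a) +
          2 * N * (4 / m * E + S * (4 / N * E))))) := by
        simp only [Finset.sum_const, card_side, nsmul_eq_mul, ← Finset.mul_sum,
          Finset.sum_add_distrib]
        push_cast; ring
    _ ≤ W * (3 * (2 * N * (S * E + 2 * N * (4 / m * E + S * (4 / N * E))))) := by gcongr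
    _ = _ := by field_simp; ring

end Poincare

/-! ### Estimates for the valley weight -/

section ValleyWeight

/-- The value at the grid point `(a, b)` of the linear form with coefficients `p`, `q`, in units of
the mesh. -/
def height (p q : ℝ) (a b : ℤ) : ℝ := p * (a - 1 / 2) + q * (b - 1 / 2)

/-- The discretized valley density in terms of `height`. -/
def weight (κ α p q : ℝ) (a b : ℤ) : ℝ := (1 + κ * |height p q a b|) ^ α

variable {ε κ α p q : ℝ} {N : ℕ}

theorem weight_pos (hκ : 0 < κ) (a b : ℤ) : 0 < weight κ α p q a b := by
  unfold weight; positivity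

theorem le_weight (hε0 : 0 < ε) (hε1 : ε ≤ 1) (hα : 0 < α) (h1 : ε ≤ κ) (a b : ℤ) :
    ε ^ α * (1 + |height p q a b|) ^ α ≤ weight κ α p q a b := by
  rw [weight, ← Real.mul_rpow hε0.le (by positivity)]
  gcongr
  nlinarith [abs_nonneg (height p q a b)]

theorem weight_le (hε0 : 0 < ε) (hε1 : ε ≤ 1) (hα : 0 < α) (h1 : ε ≤ κ) (h2 : κ ≤ 1 / ε)
    (a b : ℤ) :
    weight κ α p q a b ≤ (1 / ε) ^ α * (1 + |height p q a b|) ^ α := by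
  have h3 : 1 ≤ 1 / ε := by rw [le_div_iff₀ hε0]; linarith
  have : 0 < κ := hε0.trans_le h1
  rw [weight, ← Real.mul_rpow (by positivity) (by positivity)]
  gcongr
  nlinarith [abs_nonneg (height p q a b)]

theorem one_div_weight_le (hε0 : 0 < ε) (hε1 : ε ≤ 1) (hα : 0 < α) (h1 : ε ≤ κ) (a b : ℤ) :
    1 / weight κ α p q a b ≤ (1 / ε) ^ α * (1 + |height p q a b|) ^ (-α) := by
  have h := one_div_le_one_div_of_le (by positivity)
    (le_weight (p := p) (q := q) hε0 hε1 hα h1 a b)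
  refine h.trans (le_of_eq ?_)
  rw [Real.rpow_neg (by positivity), Real.div_rpow zero_le_one hε0.le, Real.one_rpow]
  field_simp

theorem abs_sub_half_le {a : ℤ} (ha : a ∈ side N) : |(a : ℝ) - 1 / 2| ≤ N - 1 / 2 := by
  rw [side, Finset.mem_Icc] at ha
  have h1 : -(N : ℝ) + 1 ≤ a := by exact_mod_cast ha.1
  have h2 : (a : ℝ) ≤ N := by exact_mod_cast ha.2
  rw [abs_le]; constructor <;> linarith

theorem abs_height_sub_le_vertical (hq0 : 0 ≤ q) (hq1 : q ≤ 1) {a b b' : ℤ} (h : |b - b'| ≤ 1) :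
    |height p q a b - height p q a b'| ≤ 1 := by
  have h1 : height p q a b - height p q a b' = q * ((b - b' : ℤ) : ℝ) := by
    unfold height; push_cast; ring
  have h2 : |((b - b' : ℤ) : ℝ)| ≤ 1 := by exact_mod_cast h
  rw [h1, abs_mul, abs_of_nonneg hq0]
  exact mul_le_one₀ hq1 (abs_nonneg _) h2

theorem height_swap (p q : ℝ) (a b : ℤ) : height q p a b = height p q b a := by
  unfold height; ring

theorem abs_height_sub_le_horizontal (hp0 : 0 ≤ p) (hp1 : p ≤ 1) {a a' b : ℤ}
    (h : |a - a'| ≤ 1) : |height p q a b - height p q a' b| ≤ 1 := by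
  rw [height_swap q p, height_swap q p]
  exact abs_height_sub_le_vertical hp0 hp1 h

/-- Along a column the height is `q (b + τ)` with `q ≥ 1/2`, so the sum is dominated by telescoping
increments of `potential`. One factor `2^α` pays for `q`, the other for comparing a unit interval
with its left endpoint. -/
theorem sum_column_rpow_neg_le (hα : 0 < α) (hN : 1 ≤ N) (hp0 : 0 ≤ p) (hpq : p ≤ q)
    (hq : 1 / 2 ≤ q) {a : ℤ} (ha : a ∈ side N) :
    ∑ b ∈ side N, (1 + |height p q a b|) ^ (-α) ≤ 6 * 4 ^ α * potential α N := by
  have hN1 : (1 : ℝ) ≤ N := by exact_mod_cast hN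
  have hq0 : 0 < q := by linarith
  set τ : ℝ := p / q * (a - 1 / 2) - 1 / 2 with hτ
  have hτN : |τ| ≤ N := by
    have h1 := abs_sub_half_le ha
    have h2 : |p / q| ≤ 1 := by
      rw [abs_of_nonneg (by positivity)]
      exact (div_le_one hq0).2 hpq
    have h3 : |p / q * ((a : ℝ) - 1 / 2)| ≤ N - 1 / 2 := by
      rw [abs_mul]
      calc |p / q| * |(a : ℝ) - 1 / 2| ≤ 1 * |(a : ℝ) - 1 / 2| := by gcongr
        _ ≤ _ := by rw [one_mul]; exact h1
    rw [abs_le] at *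
    constructor <;> linarith
  have hterm : ∀ b : ℤ, (1 + |height p q a b|) ^ (-α) ≤
      4 ^ α * (potential α (((b + 1 : ℤ) : ℝ) + τ) - potential α ((b : ℝ) + τ)) := by
    intro b
    have h1 : height p q a b = q * ((b : ℝ) + τ) := by
      rw [hτ, height]; field_simp; ring
    have h2 : (1 + |(b : ℝ) + τ|) / 2 ≤ 1 + |height p q a b| := by
      rw [h1, abs_mul, abs_of_pos hq0]
      nlinarith [abs_nonneg ((b : ℝ) + τ)]
    have h3 := one_add_abs_rpow_neg_le_potential_sub hα ((b : ℝ) + τ)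
    calc (1 + |height p q a b|) ^ (-α) ≤ ((1 + |(b : ℝ) + τ|) / 2) ^ (-α) :=
          Real.rpow_le_rpow_of_nonpos (by positivity) h2 (by linarith)
      _ = 2 ^ α * (1 + |(b : ℝ) + τ|) ^ (-α) := by
          rw [Real.div_rpow (by positivity) (by norm_num),
            Real.rpow_neg (by norm_num : (0:ℝ) ≤ 2)]
          field_simp
      _ ≤ 2 ^ α * (2 ^ α * (potential α ((b : ℝ) + τ + 1) - potential α ((b : ℝ) + τ))) := by
          gcongr
      _ = _ := by
          rw [show (4 : ℝ) = 2 * 2 by norm_num, Real.mul_rpow (by norm_num) (by norm_num),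
            show ((b + 1 : ℤ) : ℝ) + τ = (b : ℝ) + τ + 1 by push_cast; ring]
          ring
  have hIco : side N = Finset.Ico (-(N : ℤ) + 1) (N + 1) := by
    ext b; simp only [side, Finset.mem_Icc, Finset.mem_Ico]; omega
  have htel := sum_Ico_int_telescope (fun b => potential α ((b : ℝ) + τ))
    (i := -(N : ℤ) + 1) (j := N + 1) (by omega)
  -- Since `|τ| ≤ N`, the telescoped endpoints lie in `[-3N, 3N]`; each of the two ends contributes
  -- at most `3 * potential α N`, whence the 6.
  have h3N : potential α (3 * N) ≤ 3 * potential α N :=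
    potential_mul_le hα (by norm_num) (by linarith)
  rw [abs_le] at hτN
  have hup : potential α (((N + 1 : ℤ) : ℝ) + τ) ≤ potential α (3 * N) :=
    potential_mono α (by push_cast; linarith)
  have hlo : -potential α (3 * N) ≤ potential α (((-(N : ℤ) + 1 : ℤ) : ℝ) + τ) := by
    rw [← potential_neg]
    exact potential_mono α (by push_cast; linarith)
  calc ∑ b ∈ side N, (1 + |height p q a b|) ^ (-α)
      ≤ ∑ b ∈ side N,
        4 ^ α * (potential α (((b + 1 : ℤ) : ℝ) + τ) - potential α ((b : ℝ) + τ)) :=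
        Finset.sum_le_sum fun b _ => hterm b
    _ = 4 ^ α * (potential α (((N + 1 : ℤ) : ℝ) + τ) -
          potential α (((-(N : ℤ) + 1 : ℤ) : ℝ) + τ)) := by
        rw [← Finset.mul_sum, hIco, ← neg_sub (potential α (((-(N : ℤ) + 1 : ℤ) : ℝ) + τ)), ← htel,
          ← Finset.sum_neg_distrib]
        simp only [neg_sub]
    _ ≤ 4 ^ α * (6 * potential α N) := by
        gcongr
        linarith
    _ = _ := by ring

theorem sum_column_resistance_le (hε0 : 0 < ε) (hε1 : ε ≤ 1) (hα : 0 < α) (h1 : ε ≤ κ)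
    (hN : 1 ≤ N) (hp0 : 0 ≤ p) (hpq : p ≤ q) (hq : 1 / 2 ≤ q) (hq1 : q ≤ 1) {a : ℤ}
    (ha : a ∈ side N) :
    ∑ b ∈ Finset.Ico (-(N : ℤ) + 1) N,
      1 / min (weight κ α p q a b) (weight κ α p q a (b + 1)) ≤
        (2 / ε) ^ α * (6 * 4 ^ α * potential α N) := by
  have hκ : 0 < κ := hε0.trans_le h1
  have hterm : ∀ b : ℤ, 1 / min (weight κ α p q a b) (weight κ α p q a (b + 1)) ≤
      (2 / ε) ^ α * (1 + |height p q a b|) ^ (-α) := by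
    intro b
    have e : (2 / ε) ^ α = 2 ^ α * (1 / ε) ^ α := by
      rw [← Real.mul_rpow (by norm_num) (by positivity)]; ring_nf
    rcases min_choice (weight κ α p q a b) (weight κ α p q a (b + 1)) with h | h <;> rw [h]
    · refine (one_div_weight_le hε0 hε1 hα h1 a b).trans ?_
      gcongr
      norm_num
    · refine (one_div_weight_le hε0 hε1 hα h1 a (b + 1)).trans ?_
      rw [e, mul_comm (2 ^ α), mul_assoc]
      gcongr
      apply one_add_abs_rpow_neg_le hα
      apply abs_height_sub_le_vertical (by linarith) hq1
      simp
  calc _ ≤ ∑ b ∈ Finset.Ico (-(N : ℤ) + 1) N, (2 / ε) ^ α * (1 + |height p q a b|) ^ (-α) :=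
        Finset.sum_le_sum fun b _ => hterm b
    _ ≤ ∑ b ∈ side N, (2 / ε) ^ α * (1 + |height p q a b|) ^ (-α) :=
        Finset.sum_le_sum_of_subset_of_nonneg
          (fun b hb => by simp only [side, Finset.mem_Icc, Finset.mem_Ico] at *; omega)
          fun b _ _ => by positivity
    _ ≤ _ := by
        rw [← Finset.mul_sum]
        gcongr
        exact sum_column_rpow_neg_le hα hN hp0 hpq hq ha

theorem weight_le_of_mem_side (hε0 : 0 < ε) (hε1 : ε ≤ 1) (hα : 0 < α) (h1 : ε ≤ κ)
    (h2 : κ ≤ 1 / ε) (hN : 1 ≤ N) (hp0 : 0 ≤ p) (hp1 : p ≤ 1) (hq0 : 0 ≤ q) (hq1 : q ≤ 1)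
    {a b : ℤ} (ha : a ∈ side N) (hb : b ∈ side N) :
    weight κ α p q a b ≤ (3 / ε) ^ α * (N : ℝ) ^ α := by
  have hN1 : (1 : ℝ) ≤ N := by exact_mod_cast hN
  refine (weight_le hε0 hε1 hα h1 h2 a b).trans ?_
  rw [← Real.mul_rpow (by positivity) (by positivity),
    ← Real.mul_rpow (by positivity) (by positivity),
    show 3 / ε * N = 1 / ε * (3 * (N : ℝ)) by ring]
  gcongr
  have h3 := abs_sub_half_le ha
  have h4 := abs_sub_half_le hb
  have h5 : |height p q a b| ≤ p * |(a : ℝ) - 1 / 2| + q * |(b : ℝ) - 1 / 2| := by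
    rw [height]
    refine (abs_add_le _ _).trans (le_of_eq ?_)
    rw [abs_mul, abs_mul, abs_of_nonneg hp0, abs_of_nonneg hq0]
  nlinarith [abs_nonneg ((a : ℝ) - 1 / 2), abs_nonneg ((b : ℝ) - 1 / 2)]

/-- For `p, q ≥ 0` the line has nonpositive slope and avoids the upper right quadrant. -/
theorem le_height_of_high (hp0 : 0 ≤ p) (hq : 1 / 2 ≤ q) (hN : 1 ≤ N) {a b : ℤ}
    (ha : 1 ≤ a) (hb : (N : ℤ) ≤ 2 * b) : (N : ℝ) / 8 ≤ height p q a b := by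
  have ha' : (1 : ℝ) ≤ a := by exact_mod_cast ha
  have hb' : (N : ℝ) ≤ 2 * b := by exact_mod_cast hb
  have hb1 : (1 : ℝ) ≤ b := by
    have : 1 ≤ b := by omega
    exact_mod_cast this
  have h1 : 0 ≤ p * ((a : ℝ) - 1 / 2) := mul_nonneg hp0 (by linarith)
  have h2 : (1 / 2) * ((b : ℝ) - 1 / 2) ≤ q * ((b : ℝ) - 1 / 2) :=
    mul_le_mul_of_nonneg_right hq (by linarith)
  rw [height]
  linarith

/-- As `p ≤ q`, the line descends with slope at least `-1`; at abscissa about `N/4` it is still well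
above the rows with `b` about `-N/2` or lower. -/
theorem le_one_add_abs_height_of_low (hp0 : 0 ≤ p) (hpq : p ≤ q) (hq : 1 / 2 ≤ q)
    (hN : 1 ≤ N) {a b : ℤ} (ha : 4 * a ≤ N + 4) (hb : 2 * b ≤ 2 - (N : ℤ)) :
    (N : ℝ) / 8 ≤ 1 + |height p q a b| := by
  have ha' : 4 * (a : ℝ) ≤ N + 4 := by exact_mod_cast ha
  have hb' : 2 * (b : ℝ) ≤ 2 - N := by exact_mod_cast hb
  have hN1 : (1 : ℝ) ≤ N := by exact_mod_cast hN
  -- For `N ≤ 4` the summand 1 suffices; beyond that `N/4 - 1` is positive and `q ≥ 1/2` applies.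
  rcases le_or_gt (N : ℝ) 4 with h4 | h4
  · linarith [abs_nonneg (height p q a b)]
  have h1 : p * ((a : ℝ) - 1 / 2) ≤ q * (N / 4 + 1 / 2) := by
    calc p * ((a : ℝ) - 1 / 2) ≤ p * (N / 4 + 1 / 2) := by gcongr; linarith
      _ ≤ _ := by gcongr
  have h2 : q * ((b : ℝ) - 1 / 2) ≤ q * (1 / 2 - N / 2) := by
    apply mul_le_mul_of_nonneg_left _ (by linarith)
    linarith
  have h3 : q * (N / 4 - 1 : ℝ) ≤ |height p q a b| := by
    refine le_trans ?_ (neg_le_abs _)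
    rw [height]
    linarith
  nlinarith

theorem le_weight_of_le (hε0 : 0 < ε) (hε1 : ε ≤ 1) (hα : 0 < α) (h1 : ε ≤ κ) {a b : ℤ}
    (h : (N : ℝ) / 8 ≤ 1 + |height p q a b|) :
    (ε / 8) ^ α * (N : ℝ) ^ α ≤ weight κ α p q a b := by
  refine le_trans ?_ (le_weight hε0 hε1 hα h1 a b)
  rw [← Real.mul_rpow (by positivity) (by positivity), div_mul_eq_mul_div, mul_div_assoc,
    Real.mul_rpow hε0.le (by positivity)]
  gcongr

/-- Makes the cost `N²` of moving along rows negligible against that of crossing the valley. -/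
theorem sq_le_mul_potential (hα : 0 < α) (hN : 1 ≤ N) :
    (N : ℝ) ^ 2 ≤ 2 ^ α * ((N : ℝ) ^ (1 + α) * potential α N) := by
  have hN1 : (1 : ℝ) ≤ N := by exact_mod_cast hN
  have hN0 : (0 : ℝ) < N := by linarith
  calc (N : ℝ) ^ 2 = 2 ^ α * ((N : ℝ) ^ (1 + α) * (N * (2 * N) ^ (-α))) := by
        rw [Real.mul_rpow (by norm_num) hN0.le, Real.rpow_add hN0, Real.rpow_neg hN0.le,
          Real.rpow_one, Real.rpow_neg (by norm_num : (0 : ℝ) ≤ 2)]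
        field_simp
    _ ≤ 2 ^ α * ((N : ℝ) ^ (1 + α) * (N * (1 + N) ^ (-α))) := by
        gcongr 2 ^ α * (?_ * (?_ * ?_))
        exact Real.rpow_le_rpow_of_nonpos (by positivity) (by linarith) (by linarith)
    _ ≤ _ := by
        gcongr
        exact mul_rpow_neg_le_potential hα hN0.le

/-- The Poincaré inequality with constant `K`, together with a test function of mean zero that has
Rayleigh quotient at most `K'`. -/
def EnergyBounds (N : ℕ) (F : ℤ → ℤ → ℝ) (K K' : ℝ) : Prop :=
  (∀ w : ℤ → ℤ → ℝ, ∃ c : ℝ,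
      ∑ a ∈ side N, ∑ b ∈ side N, F a b * (w a b - c) ^ 2 ≤ K * energy N F w) ∧
    ∃ u : ℤ → ℤ → ℝ, ∑ a ∈ side N, ∑ b ∈ side N, u a b * F a b = 0 ∧
      0 < ∑ a ∈ side N, ∑ b ∈ side N, F a b * u a b ^ 2 ∧
      energy N F u ≤ K' * ∑ a ∈ side N, ∑ b ∈ side N, F a b * u a b ^ 2

theorem energy_nonneg {F : ℤ → ℤ → ℝ} (hF : ∀ a b, 0 < F a b) (u : ℤ → ℤ → ℝ) :
    0 ≤ energy N F u := by
  have := sum_columnEnergy_add_sum_rowEnergy_le (N := N) (u := u) hF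
  have h1 : 0 ≤ ∑ a ∈ side N, columnEnergy N F u a :=
    Finset.sum_nonneg fun a _ => columnEnergy_nonneg hF a
  have h2 : 0 ≤ ∑ b ∈ side N, rowEnergy N F u b :=
    Finset.sum_nonneg fun b _ => rowEnergy_nonneg hF b
  linarith

theorem weight_poincare (hε0 : 0 < ε) (hε1 : ε ≤ 1) (hα : 0 < α) (h1 : ε ≤ κ)
    (h2 : κ ≤ 1 / ε) (hN : 1 ≤ N) (hp0 : 0 ≤ p) (hpq : p ≤ q) (hq : 1 / 2 ≤ q) (hq1 : q ≤ 1)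
    (w : ℤ → ℤ → ℝ) :
    ∃ c : ℝ, ∑ a ∈ side N, ∑ b ∈ side N, weight κ α p q a b * (w a b - c) ^ 2 ≤
      (3 / ε) ^ α * (54 * ((2 / ε) ^ α * (6 * 4 ^ α)) + 48 * 2 ^ α / (ε / 8) ^ α) *
        ((N : ℝ) ^ (1 + α) * potential α N) * energy N (weight κ α p q) w := by
  have hκ : 0 < κ := hε0.trans_le h1
  have hN0 : (0 : ℝ) < N := by exact_mod_cast hN
  obtain ⟨c, hc⟩ := exists_poincare hN (weight_pos (α := α) (p := p) (q := q) hκ)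
    (W := (3 / ε) ^ α * (N : ℝ) ^ α) (m := (ε / 8) ^ α * (N : ℝ) ^ α) (by positivity)
    (fun a ha b hb => weight_le_of_mem_side hε0 hε1 hα h1 h2 hN hp0 (hpq.trans hq1)
      (by linarith) hq1 ha hb)
    (fun a ha => sum_column_resistance_le hε0 hε1 hα h1 hN hp0 hpq hq hq1 ha)
    (fun a b ha hb => le_weight_of_le hε0 hε1 hα h1 (by
      have := le_height_of_high hp0 hq hN ha hb
      linarith [le_abs_self (height p q a b)]))
    (fun a b ha hb => le_weight_of_le hε0 hε1 hα h1
      (le_one_add_abs_height_of_low hp0 hpq hq hN ha hb)) w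
  refine ⟨c, hc.trans ?_⟩
  refine mul_le_mul_of_nonneg_right ?_ (energy_nonneg (weight_pos hκ) _)
  have hsq := sq_le_mul_potential hα hN
  have hNα : 0 < (N : ℝ) ^ α := by positivity
  calc (3 / ε) ^ α * (N : ℝ) ^ α * (54 * N * ((2 / ε) ^ α * (6 * 4 ^ α * potential α N)) +
        48 * (N : ℝ) ^ 2 / ((ε / 8) ^ α * (N : ℝ) ^ α))
      = (3 / ε) ^ α * (54 * ((2 / ε) ^ α * (6 * 4 ^ α)) * ((N : ℝ) ^ (1 + α) * potential α N) +
        48 / (ε / 8) ^ α * (N : ℝ) ^ 2) := by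
        rw [Real.rpow_add hN0, Real.rpow_one]
        field_simp
    _ ≤ (3 / ε) ^ α * (54 * ((2 / ε) ^ α * (6 * 4 ^ α)) * ((N : ℝ) ^ (1 + α) * potential α N) +
        48 / (ε / 8) ^ α * (2 ^ α * ((N : ℝ) ^ (1 + α) * potential α N))) := by
        gcongr
    _ = _ := by ring

/-! ### The test function -/

theorem sum_side_reflect (N : ℕ) (f : ℤ → ℝ) : ∑ a ∈ side N, f (1 - a) = ∑ a ∈ side N, f a :=
  Finset.sum_nbij' (fun a => 1 - a) (fun a => 1 - a)
    (fun a ha => by simp only [side, Finset.mem_Icc] at *; omega)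
    (fun a ha => by simp only [side, Finset.mem_Icc] at *; omega)
    (fun a _ => by ring) (fun a _ => by ring) (fun a _ => rfl)

theorem height_reflect (p q : ℝ) (a b : ℤ) : height p q (1 - a) (1 - b) = -height p q a b := by
  unfold height; push_cast; ring

/-- The half-integer shift makes `(a, b) ↦ (1 - a, 1 - b)` an exact symmetry of the box that negates
the height; the weight is even and the potential odd. -/
theorem sum_potential_mul_weight (κ α p q : ℝ) (N : ℕ) :
    ∑ a ∈ side N, ∑ b ∈ side N, potential α (height p q a b) * weight κ α p q a b = 0 := by
  have h : ∑ a ∈ side N, ∑ b ∈ side N, potential α (height p q a b) * weight κ α p q a b =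
      -∑ a ∈ side N, ∑ b ∈ side N, potential α (height p q a b) * weight κ α p q a b := by
    conv_lhs => rw [← sum_side_reflect]
    rw [← Finset.sum_neg_distrib]
    refine Finset.sum_congr rfl fun a _ => ?_
    conv_lhs => rw [← sum_side_reflect]
    rw [← Finset.sum_neg_distrib]
    refine Finset.sum_congr rfl fun b _ => ?_
    simp only [weight, height_reflect, abs_neg, potential_neg]
    ring
  linarith

theorem energy_potential_le (hε0 : 0 < ε) (hε1 : ε ≤ 1) (hα : 0 < α) (h1 : ε ≤ κ)
    (h2 : κ ≤ 1 / ε) (hN : 1 ≤ N) (hp0 : 0 ≤ p) (hpq : p ≤ q) (hq : 1 / 2 ≤ q) (hq1 : q ≤ 1) :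
    energy N (weight κ α p q) (fun a b => potential α (height p q a b)) ≤
      48 * (1 / ε) ^ α * 4 ^ α * 4 ^ α * (N * potential α N) := by
  -- The weight `(1 + |h|)^α` times the squared increment, of order `(1 + |h|)^(-2α)`, leaves the
  -- summand `(1 + |h|)^(-α)` of the column resistance.
  have hedge : ∀ a b a' b' : ℤ, |height p q a b - height p q a' b'| ≤ 1 →
      min (weight κ α p q a b) (weight κ α p q a' b') *
        (potential α (height p q a b) - potential α (height p q a' b')) ^ 2 ≤
      (1 / ε) ^ α * 4 ^ α * (1 + |height p q a b|) ^ (-α) := by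
    intro a b a' b' h
    have h3 := abs_potential_sub_le hα h
    have h4 : (potential α (height p q a b) - potential α (height p q a' b')) ^ 2 ≤
        (2 ^ α * (1 + |height p q a b|) ^ (-α)) ^ 2 := by
      rw [← sq_abs]; gcongr
    calc _ ≤ ((1 / ε) ^ α * (1 + |height p q a b|) ^ α) *
          (2 ^ α * (1 + |height p q a b|) ^ (-α)) ^ 2 :=
          mul_le_mul ((min_le_left _ _).trans (weight_le hε0 hε1 hα h1 h2 a b)) h4
            (sq_nonneg _) (by positivity)
      _ = _ := by
          rw [show (4 : ℝ) = 2 * 2 by norm_num, Real.mul_rpow (by norm_num) (by norm_num),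
            Real.rpow_neg (by positivity)]
          have : (1 + |height p q a b|) ^ α ≠ 0 := by positivity
          field_simp
  have hnb : ∀ (i : ℤ) (g : ℤ → ℝ) (c : ℝ), i ∈ side N → 0 ≤ c →
      (∀ j, |i - j| ≤ 1 → g j ≤ c) → (∑ j ∈ side N, if |i - j| = 1 then g j else 0) ≤ 2 * c := by
    classical
    intro i g c hi hc hg
    calc (∑ j ∈ side N, if |i - j| = 1 then g j else 0)
        ≤ ∑ j ∈ side N, if |i - j| = 1 then c else 0 := by
          refine Finset.sum_le_sum fun j _ => ?_
          split_ifs with h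
          · exact hg j h.le
          · exact le_rfl
      _ ≤ 2 * c := by
          rw [sum_side_neighbors hi]
          split_ifs <;> linarith
  calc energy N (weight κ α p q) (fun a b => potential α (height p q a b))
      ≤ ∑ a ∈ side N, ∑ b ∈ side N, 4 * ((1 / ε) ^ α * 4 ^ α) * (1 + |height p q a b|) ^ (-α) := by
        refine Finset.sum_le_sum fun a ha => Finset.sum_le_sum fun b hb => ?_
        have hc : 0 ≤ (1 / ε) ^ α * 4 ^ α * (1 + |height p q a b|) ^ (-α) := by positivity
        have e1 := hnb a (fun a' => min (weight κ α p q a b) (weight κ α p q a' b) *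
          (potential α (height p q a b) - potential α (height p q a' b)) ^ 2) _ ha hc
          fun j hj => hedge a b j b (abs_height_sub_le_horizontal hp0 (hpq.trans hq1) hj)
        have e2 := hnb b (fun b' => min (weight κ α p q a b) (weight κ α p q a b') *
          (potential α (height p q a b) - potential α (height p q a b')) ^ 2) _ hb hc
          fun j hj => hedge a b a j (abs_height_sub_le_vertical (by linarith) hq1 hj)
        refine (add_le_add e1 e2).trans (le_of_eq (by ring))
    _ ≤ ∑ a ∈ side N, 4 * ((1 / ε) ^ α * 4 ^ α) * (6 * 4 ^ α * potential α N) := by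
        refine Finset.sum_le_sum fun a ha => ?_
        rw [← Finset.mul_sum]
        gcongr
        exact sum_column_rpow_neg_le hα hN hp0 hpq hq ha
    _ = _ := by
        rw [Finset.sum_const, card_side, nsmul_eq_mul]
        push_cast; ring

theorem le_sum_weight_mul_potential_sq (hε0 : 0 < ε) (hε1 : ε ≤ 1) (hα : 0 < α) (h1 : ε ≤ κ)
    (hN : 1 ≤ N) (hp0 : 0 ≤ p) (hq : 1 / 2 ≤ q) :
    (ε / 8) ^ α / 128 * ((N : ℝ) ^ 2 * (N : ℝ) ^ α * potential α N ^ 2) ≤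
      ∑ a ∈ side N, ∑ b ∈ side N, weight κ α p q a b * potential α (height p q a b) ^ 2 := by
  have hκ : 0 < κ := hε0.trans_le h1
  have hN0 : (0 : ℝ) < N := by exact_mod_cast hN
  have hP : 0 < potential α N := potential_pos hα hN0
  have hnn : ∀ a b, 0 ≤ weight κ α p q a b * potential α (height p q a b) ^ 2 := fun a b =>
    mul_nonneg (weight_pos hκ a b).le (sq_nonneg _)
  have hcard : (N : ℝ) / 2 ≤ (Finset.Icc (((N + 1) / 2 : ℕ) : ℤ) N).card := by
    rw [Int.card_Icc]
    have : N ≤ 2 * (((N : ℤ) + 1 - (((N + 1) / 2 : ℕ) : ℤ)).toNat) := by omega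
    have : (N : ℝ) ≤ 2 * ((((N : ℤ) + 1 - (((N + 1) / 2 : ℕ) : ℤ)).toNat : ℕ) : ℝ) := by
      exact_mod_cast this
    linarith
  -- Only the upper half of the right half of the box is kept: at least `N * (N / 2)` points at
  -- height at least `N / 8`. With the square of `1/8` this gives the constant 128.
  have hpt : ∀ a b : ℤ, 1 ≤ a → (N : ℤ) ≤ 2 * b →
      (ε / 8) ^ α * (N : ℝ) ^ α * (potential α N / 8) ^ 2 ≤
        weight κ α p q a b * potential α (height p q a b) ^ 2 := by
    intro a b ha hb
    have h3 := le_height_of_high hp0 hq hN ha hb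
    have h4 : (ε / 8) ^ α * (N : ℝ) ^ α ≤ weight κ α p q a b :=
      le_weight_of_le hε0 hε1 hα h1 (by linarith [le_abs_self (height p q a b)])
    have h5 : potential α N / 8 ≤ potential α (height p q a b) := by
      refine le_trans ?_ (potential_mono α h3)
      have := potential_mul_le (r := 8) (s := (N : ℝ) / 8) hα (by norm_num) (by positivity)
      rw [mul_div_cancel₀ _ (by norm_num)] at this
      linarith
    exact mul_le_mul h4 (pow_le_pow_left₀ (by positivity) h5 2) (sq_nonneg _) (weight_pos hκ a b).le
  calc (ε / 8) ^ α / 128 * ((N : ℝ) ^ 2 * (N : ℝ) ^ α * potential α N ^ 2)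
      = N * ((N / 2) * ((ε / 8) ^ α * (N : ℝ) ^ α * (potential α N / 8) ^ 2)) := by ring
    _ ≤ N * ((Finset.Icc (((N + 1) / 2 : ℕ) : ℤ) N).card *
          ((ε / 8) ^ α * (N : ℝ) ^ α * (potential α N / 8) ^ 2)) := by gcongr
    _ = ∑ a ∈ Finset.Icc (1 : ℤ) N, ∑ b ∈ Finset.Icc (((N + 1) / 2 : ℕ) : ℤ) N,
          (ε / 8) ^ α * (N : ℝ) ^ α * (potential α N / 8) ^ 2 := by
        simp only [Finset.sum_const, nsmul_eq_mul]
        congr 1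
        rw [Int.card_Icc]; simp
    _ ≤ ∑ a ∈ Finset.Icc (1 : ℤ) N, ∑ b ∈ Finset.Icc (((N + 1) / 2 : ℕ) : ℤ) N,
          weight κ α p q a b * potential α (height p q a b) ^ 2 := by
        refine Finset.sum_le_sum fun a ha => Finset.sum_le_sum fun b hb => hpt a b ?_ ?_
        · exact (Finset.mem_Icc.1 ha).1
        · have := (Finset.mem_Icc.1 hb).1
          omega
    _ ≤ ∑ a ∈ Finset.Icc (1 : ℤ) N, ∑ b ∈ side N,
          weight κ α p q a b * potential α (height p q a b) ^ 2 :=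
        Finset.sum_le_sum fun a _ => Finset.sum_le_sum_of_subset_of_nonneg
          (fun b hb => by simp only [side, Finset.mem_Icc] at *; omega) fun b _ _ => hnn a b
    _ ≤ _ := Finset.sum_le_sum_of_subset_of_nonneg
        (fun b hb => by simp only [side, Finset.mem_Icc] at *; omega)
        fun a _ _ => Finset.sum_nonneg fun b _ => hnn a b

theorem weight_energyBounds_of_le (hε0 : 0 < ε) (hε1 : ε ≤ 1) (hα : 0 < α) :
    ∃ K K' : ℝ, 0 < K ∧ 0 < K' ∧ ∀ (κ p q : ℝ) (N : ℕ), ε ≤ κ → κ ≤ 1 / ε → 1 ≤ N →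
      0 ≤ p → p ≤ q → p ^ 2 + q ^ 2 = 1 →
      EnergyBounds N (weight κ α p q) (K * ((N : ℝ) ^ (1 + α) * potential α N))
        (K' * (1 / ((N : ℝ) ^ (1 + α) * potential α N))) := by
  refine ⟨(3 / ε) ^ α * (54 * ((2 / ε) ^ α * (6 * 4 ^ α)) + 48 * 2 ^ α / (ε / 8) ^ α),
    48 * (1 / ε) ^ α * 4 ^ α * 4 ^ α / ((ε / 8) ^ α / 128), by positivity, by positivity, ?_⟩
  intro κ p q N h1 h2 hN hp0 hpq hpq1
  have hq : 1 / 2 ≤ q := by nlinarith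
  have hq1 : q ≤ 1 := by nlinarith
  have hN0 : (0 : ℝ) < N := by exact_mod_cast hN
  have hP : 0 < potential α N := potential_pos hα hN0
  have hlow := le_sum_weight_mul_potential_sq hε0 hε1 hα h1 hN hp0 hq
  refine ⟨weight_poincare hε0 hε1 hα h1 h2 hN hp0 hpq hq hq1,
    fun a b => potential α (height p q a b), sum_potential_mul_weight κ α p q N, ?_, ?_⟩
  · exact lt_of_lt_of_le (by positivity) hlow
  · refine (energy_potential_le hε0 hε1 hα h1 h2 hN hp0 hpq hq hq1).trans ?_
    refine le_trans (le_of_eq ?_) (mul_le_mul_of_nonneg_left hlow (by positivity))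
    rw [Real.rpow_add hN0, Real.rpow_one]
    have : (N : ℝ) ^ α ≠ 0 := by positivity
    have : (ε / 8) ^ α ≠ 0 := by positivity
    field_simp

/-! ### Symmetries of the square and reduction to one octant of normals -/

theorem energy_swap (F u : ℤ → ℤ → ℝ) :
    energy N (fun a b => F b a) (fun a b => u b a) = energy N F u := by
  simp only [energy]
  rw [Finset.sum_comm]
  refine Finset.sum_congr rfl fun a _ => Finset.sum_congr rfl fun b _ => ?_
  rw [add_comm]

theorem energy_reflect (F u : ℤ → ℤ → ℝ) :
    energy N (fun a b => F (1 - a) b) (fun a b => u (1 - a) b) = energy N F u := by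
  simp only [energy]
  rw [← sum_side_reflect N fun a => ∑ b ∈ side N,
    ((∑ a' ∈ side N, if |a - a'| = 1 then min (F a b) (F a' b) * (u a b - u a' b) ^ 2 else 0) +
      ∑ b' ∈ side N, if |b - b'| = 1 then min (F a b) (F a b') * (u a b - u a b') ^ 2 else 0)]
  refine Finset.sum_congr rfl fun a _ => Finset.sum_congr rfl fun b _ => ?_
  congr 1
  rw [← sum_side_reflect]
  refine Finset.sum_congr rfl fun a' _ => ?_
  have h : |1 - a - a'| = |a - (1 - a')| := by rw [abs_sub_comm]; ring_nf
  simp only [h, sub_sub_cancel]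

theorem EnergyBounds.swap {F : ℤ → ℤ → ℝ} {K K' : ℝ} (h : EnergyBounds N F K K') :
    EnergyBounds N (fun a b => F b a) K K' := by
  obtain ⟨h1, u, hu0, hu, hK'⟩ := h
  refine ⟨fun w => ?_, fun a b => u b a, ?_, ?_, ?_⟩
  · obtain ⟨c, hc⟩ := h1 fun a b => w b a
    refine ⟨c, ?_⟩
    rw [← energy_swap, Finset.sum_comm] at hc
    exact hc
  · rw [Finset.sum_comm]; exact hu0
  · rw [Finset.sum_comm]; exact hu
  · rw [Finset.sum_comm, energy_swap]; exact hK'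

theorem EnergyBounds.reflect {F : ℤ → ℤ → ℝ} {K K' : ℝ} (h : EnergyBounds N F K K') :
    EnergyBounds N (fun a b => F (1 - a) b) K K' := by
  obtain ⟨h1, u, hu0, hu, hK'⟩ := h
  refine ⟨fun w => ?_, fun a b => u (1 - a) b, ?_, ?_, ?_⟩
  · obtain ⟨c, hc⟩ := h1 fun a b => w (1 - a) b
    refine ⟨c, ?_⟩
    rw [← energy_reflect, ← sum_side_reflect] at hc
    simpa only [sub_sub_cancel] using hc
  · rw [sum_side_reflect N fun a => ∑ b ∈ side N, u a b * F a b]; exact hu0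
  · rw [sum_side_reflect N fun a => ∑ b ∈ side N, F a b * u a b ^ 2]; exact hu
  · rw [sum_side_reflect N fun a => ∑ b ∈ side N, F a b * u a b ^ 2, energy_reflect]; exact hK'

theorem weight_swap (κ α p q : ℝ) :
    (fun a b => weight κ α p q b a) = weight κ α q p := by
  ext a b; rw [weight, weight, height_swap p q]

theorem weight_reflect (κ α p q : ℝ) :
    (fun a b => weight κ α p q (1 - a) b) = weight κ α (-p) q := by
  ext a b
  have : height p q (1 - a) b = height (-p) q a b := by
    unfold height; push_cast; ring
  rw [weight, weight, this]

theorem weight_neg (κ α p q : ℝ) : weight κ α (-p) (-q) = weight κ α p q := by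
  ext a b
  have : height (-p) (-q) a b = -height p q a b := by
    unfold height; ring
  rw [weight, weight, this, abs_neg]

theorem weight_energyBounds (hε0 : 0 < ε) (hε1 : ε ≤ 1) (hα : 0 < α) :
    ∃ K K' : ℝ, 0 < K ∧ 0 < K' ∧ ∀ (κ p q : ℝ) (N : ℕ), ε ≤ κ → κ ≤ 1 / ε → 1 ≤ N →
      p ^ 2 + q ^ 2 = 1 →
      EnergyBounds N (weight κ α p q) (K * ((N : ℝ) ^ (1 + α) * potential α N))
        (K' * (1 / ((N : ℝ) ^ (1 + α) * potential α N))) := by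
  obtain ⟨K, K', hK, hK', h⟩ := weight_energyBounds_of_le hε0 hε1 hα
  refine ⟨K, K', hK, hK', fun κ p q N h1 h2 hN hpq => ?_⟩
  -- Exchanging the coordinates removes `p ≤ q`; reflecting the first coordinate then removes `0 ≤
  -- p`, and the sign of the normal is immaterial.
  have hquad : ∀ p q : ℝ, p ^ 2 + q ^ 2 = 1 → 0 ≤ p → 0 ≤ q →
      EnergyBounds N (weight κ α p q) (K * ((N : ℝ) ^ (1 + α) * potential α N))
        (K' * (1 / ((N : ℝ) ^ (1 + α) * potential α N))) := by
    intro p q hpq hp hq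
    rcases le_total p q with hle | hle
    · exact h κ p q N h1 h2 hN hp hle hpq
    · rw [← weight_swap]
      exact (h κ q p N h1 h2 hN hq hle (by linarith)).swap
  have hupper : ∀ p q : ℝ, p ^ 2 + q ^ 2 = 1 → 0 ≤ q →
      EnergyBounds N (weight κ α p q) (K * ((N : ℝ) ^ (1 + α) * potential α N))
        (K' * (1 / ((N : ℝ) ^ (1 + α) * potential α N))) := by
    intro p q hpq hq
    rcases le_total 0 p with hp | hp
    · exact hquad p q hpq hp hq
    · rw [← neg_neg p, ← weight_reflect]
      exact (hquad (-p) q (by linarith [neg_sq p]) (by linarith) hq).reflect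
  rcases le_total 0 q with hq | hq
  · exact hupper p q hpq hq
  · rw [← weight_neg]
    exact hupper (-p) (-q) (by linarith [neg_sq p, neg_sq q]) (by linarith)

end ValleyWeight

/-! ### Distance to a line through the origin -/

section Line

theorem exists_infDist_eq (L : Submodule ℝ (EuclideanSpace ℝ (Fin 2)))
    (hL : Module.finrank ℝ L = 1) :
    ∃ p q : ℝ, p ^ 2 + q ^ 2 = 1 ∧ ∀ x : EuclideanSpace ℝ (Fin 2),
      Metric.infDist x (L : Set (EuclideanSpace ℝ (Fin 2))) = |p * x 0 + q * x 1| := by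
  obtain ⟨⟨v, hv⟩, hv0, hspan⟩ := finrank_eq_one_iff'.1 hL
  have hv0' : v ≠ 0 := fun h => hv0 (Subtype.ext h)
  set n := ‖v‖ with hn
  have hn0 : 0 < n := norm_pos_iff.2 hv0'
  have hn2 : n ^ 2 = v 0 ^ 2 + v 1 ^ 2 := by
    rw [hn, EuclideanSpace.real_norm_sq_eq, Fin.sum_univ_two]
  have hunit : (v 0 / n) ^ 2 + (v 1 / n) ^ 2 = 1 := by
    rw [div_pow, div_pow, ← add_div, ← hn2, div_self (by positivity)]
  set r := v 0 / n with hr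
  set s := v 1 / n with hs
  -- `(r, s)` is a unit direction of the line, `(-s, r)` a unit normal, and `w` the orthogonal
  -- projection of `x`.
  refine ⟨-s, r, by linarith [neg_sq s], fun x => ?_⟩
  let w : EuclideanSpace ℝ (Fin 2) := ((r * x 0 + s * x 1) / n) • v
  have hw : w ∈ L := L.smul_mem _ hv
  apply le_antisymm
  · refine (Metric.infDist_le_dist_of_mem hw).trans (le_of_eq ?_)
    rw [EuclideanSpace.dist_eq, Fin.sum_univ_two, Real.dist_eq, Real.dist_eq, sq_abs, sq_abs,
      ← Real.sqrt_sq_eq_abs]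
    congr 1
    have h0 : w 0 = (r * x 0 + s * x 1) * r := by
      simp only [w, PiLp.smul_apply, smul_eq_mul, hr]; ring
    have h1 : w 1 = (r * x 0 + s * x 1) * s := by
      simp only [w, PiLp.smul_apply, smul_eq_mul, hs]; ring
    rw [h0, h1]
    linear_combination ((r * x 0 + s * x 1) ^ 2 - x 0 ^ 2 - x 1 ^ 2) * hunit
  · rw [Metric.le_infDist ⟨w, hw⟩]
    intro y hy
    obtain ⟨c, hc⟩ := hspan ⟨y, hy⟩
    have hc' : c • v = y := congrArg Subtype.val hc
    rw [EuclideanSpace.dist_eq, Fin.sum_univ_two, Real.dist_eq, Real.dist_eq, sq_abs, sq_abs,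
      ← Real.sqrt_sq_eq_abs]
    apply Real.sqrt_le_sqrt
    have h0 : y 0 = c * n * r := by
      rw [← hc', hr]; simp only [PiLp.smul_apply, smul_eq_mul]; field_simp
    have h1 : y 1 = c * n * s := by
      rw [← hc', hs]; simp only [PiLp.smul_apply, smul_eq_mul]; field_simp
    -- Pythagoras: the first square is the normal component, the same for every `y` in `L`; the
    -- second is the tangential one and can be dropped.
    have key : (x 0 - y 0) ^ 2 + (x 1 - y 1) ^ 2 =
        (-s * x 0 + r * x 1) ^ 2 + (r * (x 0 - y 0) + s * (x 1 - y 1)) ^ 2 := by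
      rw [h0, h1]
      linear_combination (-(x 0 - c * n * r) ^ 2 - (x 1 - c * n * s) ^ 2) * hunit
    rw [key]
    nlinarith [sq_nonneg (r * (x 0 - y 0) + s * (x 1 - y 1))]

theorem discreteDensity_eq_weight {N : ℕ} (hN : 1 ≤ N) (A α : ℝ)
    {L : Submodule ℝ (EuclideanSpace ℝ (Fin 2))} {p q : ℝ}
    (hL : ∀ x : EuclideanSpace ℝ (Fin 2),
      Metric.infDist x (L : Set (EuclideanSpace ℝ (Fin 2))) = |p * x 0 + q * x 1|) :
    discreteDensity N A α L = fun k : Box N => weight (A / N) α p q k.1 k.2 := by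
  ext k
  have hN0 : (0 : ℝ) < N := by exact_mod_cast hN
  rw [discreteDensity, density, hL, weight, height]
  congr 2
  have h : p * (((k.1 : ℤ) : ℝ) - 1 / 2) / N + q * (((k.2 : ℤ) : ℝ) - 1 / 2) / N =
      (p * (((k.1 : ℤ) : ℝ) - 1 / 2) + q * (((k.2 : ℤ) : ℝ) - 1 / 2)) / N := by ring
  simp only [Matrix.cons_val_zero, Matrix.cons_val_one]
  rw [← mul_div_assoc, ← mul_div_assoc, h, abs_div, abs_of_pos hN0]
  ring

end Line

end Valley

end

/-! ### Conclusion -/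

theorem mainTheorem1 (ε : ℝ) (hε0 : 0 < ε) (hε1 : ε < 1) (α : ℝ) (hα : 0 < α) :
    ∃ c C : ℝ, 0 < c ∧ c ≤ C ∧
      ∀ (L : Submodule ℝ (EuclideanSpace ℝ (Fin 2))), Module.finrank ℝ L = 1 →
        ∀ (A : ℝ), 0 < A → ∀ (N : ℕ), 1 ≤ N → (α = 1 → 2 ≤ N) →
          ε * A ≤ (N : ℝ) → (N : ℝ) ≤ A / ε →
            c * Valley.rate α N ≤ Valley.valleyGap N A α L ∧
              Valley.valleyGap N A α L ≤ C * Valley.rate α N := by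
  open Valley in
  obtain ⟨K, K', hK, hK', hbounds⟩ := weight_energyBounds hε0 hε1.le hα
  obtain ⟨m, M, hm, hM, hrate⟩ := rate_comparison hα
  -- The maximum only serves to ensure `c ≤ C`.
  refine ⟨m / (8 * K), max (m / (8 * K)) (K' / 8 * M), by positivity, le_max_left _ _, ?_⟩
  intro L hL A hA N hN hN2 hA1 hA2
  obtain ⟨p, q, hpq, hdist⟩ := exists_infDist_eq L hL
  have hN0 : (0 : ℝ) < N := by exact_mod_cast hN
  -- The hypothesis on `A` and `N` says exactly that `κ = A / N` lies in `[ε, 1/ε]`.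
  have hκ1 : ε ≤ A / N := by
    rw [le_div_iff₀ hN0]
    rw [le_div_iff₀ hε0] at hA2
    linarith
  have hκ2 : A / N ≤ 1 / ε := by
    rw [div_le_div_iff₀ hN0 hε0]
    linarith
  have hP := potential_pos hα hN0
  obtain ⟨hpoincare, u, hu0, hu, htest⟩ := hbounds (A / N) p q N hκ1 hκ2 hN hpq
  obtain ⟨h1, h2⟩ := metropolis_gap_bounds (weight_pos (hε0.trans_le hκ1)) (by positivity)
    hpoincare hu0 hu htest
  rw [← discreteDensity_eq_weight hN A α hdist] at h1 h2
  obtain ⟨hr1, hr2⟩ := hrate N hN hN2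
  have hr0 : 0 ≤ rate α N := by
    by_contra hneg
    have h3 : M * rate α N < 0 := mul_neg_of_pos_of_neg hM (not_le.1 hneg)
    have : 0 < 1 / ((N : ℝ) ^ (1 + α) * potential α N) := by positivity
    linarith
  constructor
  · refine le_trans ?_ h1
    calc m / (8 * K) * rate α N = 1 / (8 * K) * (m * rate α N) := by ring
      _ ≤ 1 / (8 * K) * (1 / ((N : ℝ) ^ (1 + α) * potential α N)) := by gcongr
      _ = _ := by rw [one_div_mul_one_div, mul_assoc]
  · refine h2.trans ?_
    calc K' * (1 / ((N : ℝ) ^ (1 + α) * potential α N)) / 8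
        = K' / 8 * (1 / ((N : ℝ) ^ (1 + α) * potential α N)) := by ring
      _ ≤ K' / 8 * (M * rate α N) := by gcongr
      _ = K' / 8 * M * rate α N := by ring
      _ ≤ _ := mul_le_mul_of_nonneg_right (le_max_right _ _) hr0
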